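/- Let $M$ be a smooth manifold of dimension $n$ and $F:TM\to[0,+\infty)$ a Finsler metric: $F$ is continuous, smooth on $TM\setminus 0$, and on each $T_xM$ it is positive away from $0$, positively $1$-homogeneous, with positive definite fundamental tensor $g_{ij}=\frac12[F^2]_{y^iy^j}$ at every $y\ne0$. Suppose that (a) $F$ is an $(\alpha_1,\alpha_2)$ metric: there are a Riemannian metric $\alpha$ on $M$ and an $\alpha$-orthogonal decomposition $TM=\mathcal V_1+\mathcal V_2$ into two smooth linear sub-bundles such that $F(y)$ depends only on the values $\alpha(y_1)$ and $\alpha(y_2)$, where $y=y_1+y_2\in TM$ with $y_i\in\mathcal V_i$ (that is, $F=\sqrt{L(\alpha_1^2,\alpha_2^2)}$ with $\alpha_i(y)=\alpha(y_i)$ for one function $L$); (b) $F$ is homogeneous: the group of isometries of $(M,F)$, i.e. of diffeomorphisms of $M$ preserving $F$, acts transitively on $M$. In standard local coordinates $(x^i,y^i)$ on $TM$ put $\mathbf G^i=\frac14 g^{il}([F^2]_{x^ky^l}y^k-[F^2]_{x^l})$ and let $\mathbf G=y^i\partial_{x^i}-2\mathbf G^i\partial_{y^i}$ be the geodesic spray.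 Let $\sigma(x)=\mathrm{Vol}(B_n(1))/\mathrm{Vol}\{(y^i)\in\mathbb R^n: F(x,y^i\partial_{x^i})<1\}$ be the density of the Busemann–Hausdorff measure. The S-curvature $S(x,y)$ is the derivative of $\tau=\ln\bigl(\sqrt{\det(g_{ij})}/\sigma\bigr)$ in the direction of $\mathbf G$, the E-curvature is $E_{ij}=\frac12\sum_k\frac{\partial^3\mathbf G^k}{\partial y^i\partial y^j\partial y^k}$, and $h_{ij}=FF_{y^iy^j}$. Then the following four conditions are equivalent: 1. $F$ has weakly isotropic S-curvature: there are a function $c$ and a one-form $\epsilon$ on $M$ such that $S(x,y)=(n+1)c(x)F(x,y)+\epsilon(x,y)$ for all $(x,y)\in TM\setminus0$; 2. $F$ has vanishing S-curvature: $S(x,y)=0$ for all $(x,y)\in TM\setminus0$; 3. $F$ has isotropic E-curvature: there is a function $c$ on $M$ such that $E_{ij}=\frac{n+1}{2}c(x)F^{-1}h_{ij}$ for all $i,j$ on $TM\setminus0$, in all standard local coordinates; 4. $F$ has vanishing E-curvature: $E_{ij}=0$ for all $i,j$ on $TM\setminus0$. (No regularity of $c$ and $\epsilon$ in $x$ is required;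 the equivalence is the same if they are required to be smooth.) -/

import Mathlib

open scoped Manifold ContDiff

namespace Finsler

/-! ### Minkowski norms -/

/-- The fundamental tensor
`g_y(u,v) = (1/2) ∂²/∂s∂t [F²(y + s u + t v)]` at `s = t = 0`. -/
noncomputable def fundamentalTensor {V : Type*} [AddCommGroup V] [Module ℝ V]
    (F : V → ℝ) (y u v : V) : ℝ :=
  (1 / 2) * deriv (fun s : ℝ => deriv (fun t : ℝ => F (y + s • u + t • v) ^ 2) 0) 0

/-- Minkowski norms on a (finite dimensional) real vector space. Symmetry and bilinearity of `g_y`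
are automatic by smoothness, so that `g_y` is an inner product if and only if it is positive
definite. -/
structure IsMinkowskiNorm {V : Type*} [NormedAddCommGroup V] [NormedSpace ℝ V]
    (F : V → ℝ) : Prop where
  continuous : Continuous F
  nonneg : ∀ y, 0 ≤ F y
  pos : ∀ y, y ≠ 0 → 0 < F y
  smooth : ContDiffOn ℝ ∞ F {y | y ≠ 0}
  homogeneous : ∀ (c : ℝ) (y : V), 0 ≤ c → F (c • y) = c * F y
  stronglyConvex : ∀ y, y ≠ 0 → ∀ u, u ≠ 0 → 0 < fundamentalTensor F y u u

/-! ### Curvatures in a standard local coordinate system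

Here `L u v` stands for `F (x, y)`, where `u` is the coordinate vector of `x` and `v` the one
of the tangent vector `y` at `x`. -/

section Local

variable {n : ℕ}

/-- The partial derivative `∂f/∂xⁱ` of a function of `(x, y)`. -/
noncomputable def dx (i : Fin n)
    (f : EuclideanSpace ℝ (Fin n) → EuclideanSpace ℝ (Fin n) → ℝ)
    (u v : EuclideanSpace ℝ (Fin n)) : ℝ :=
  lineDeriv ℝ (fun w => f w v) u (EuclideanSpace.single i 1)

/-- The partial derivative `∂f/∂yⁱ` of a function of `(x, y)`. -/
noncomputable def dy (i : Fin n)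
    (f : EuclideanSpace ℝ (Fin n) → EuclideanSpace ℝ (Fin n) → ℝ)
    (u v : EuclideanSpace ℝ (Fin n)) : ℝ :=
  lineDeriv ℝ (fun w => f u w) v (EuclideanSpace.single i 1)

/-- The matrix `g_ij = (1/2) ∂²(F²)/∂yⁱ∂yʲ`. -/
noncomputable def gMatrix
    (L : EuclideanSpace ℝ (Fin n) → EuclideanSpace ℝ (Fin n) → ℝ)
    (u v : EuclideanSpace ℝ (Fin n)) : Matrix (Fin n) (Fin n) ℝ :=
  Matrix.of fun i j => (1 / 2) * dy i (dy j (fun p w => L p w ^ 2)) u v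

/-- The coefficients `Gⁱ = (1/4) gⁱˡ ([F²]_{xᵏyˡ} yᵏ - [F²]_{xˡ})` of the geodesic spray
`yⁱ ∂_{xⁱ} - 2 Gⁱ ∂_{yⁱ}`. -/
noncomputable def sprayCoeff
    (L : EuclideanSpace ℝ (Fin n) → EuclideanSpace ℝ (Fin n) → ℝ) (i : Fin n)
    (u v : EuclideanSpace ℝ (Fin n)) : ℝ :=
  (1 / 4) * ∑ l, (gMatrix L u v)⁻¹ i l *
    ((∑ k, dx k (dy l (fun p w => L p w ^ 2)) u v * v k) - dx l (fun p w => L p w ^ 2) u v)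

/-- The density `σ` of the Busemann–Hausdorff measure `σ(x) dx¹⋯dxⁿ`. -/
noncomputable def bhDensity
    (L : EuclideanSpace ℝ (Fin n) → EuclideanSpace ℝ (Fin n) → ℝ)
    (u : EuclideanSpace ℝ (Fin n)) : ℝ :=
  MeasureTheory.volume.real (Metric.ball (0 : EuclideanSpace ℝ (Fin n)) 1) /
    MeasureTheory.volume.real {v : EuclideanSpace ℝ (Fin n) | L u v < 1}

/-- The distortion `τ = ln (√det(g_ij) / σ)`. -/
noncomputable def distortion
    (L : EuclideanSpace ℝ (Fin n) → EuclideanSpace ℝ (Fin n) → ℝ)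
    (u v : EuclideanSpace ℝ (Fin n)) : ℝ :=
  Real.log (Real.sqrt (gMatrix L u v).det / bhDensity L u)

/-- The S-curvature: the derivative of the distortion in the direction of the geodesic spray. -/
noncomputable def localS
    (L : EuclideanSpace ℝ (Fin n) → EuclideanSpace ℝ (Fin n) → ℝ)
    (u v : EuclideanSpace ℝ (Fin n)) : ℝ :=
  ∑ i, (v i * dx i (distortion L) u v - 2 * sprayCoeff L i u v * dy i (distortion L) u v)

/-- The Berwald curvature `Bⁱ_{jkl} = ∂³Gⁱ/∂yʲ∂yᵏ∂yˡ`. -/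
noncomputable def berwald
    (L : EuclideanSpace ℝ (Fin n) → EuclideanSpace ℝ (Fin n) → ℝ) (i j k l : Fin n)
    (u v : EuclideanSpace ℝ (Fin n)) : ℝ :=
  dy j (dy k (dy l (sprayCoeff L i))) u v

/-- The mean Berwald curvature (E-curvature) `E_ij = (1/2) Bᵏ_{ijk}`. -/
noncomputable def localE
    (L : EuclideanSpace ℝ (Fin n) → EuclideanSpace ℝ (Fin n) → ℝ) (i j : Fin n)
    (u v : EuclideanSpace ℝ (Fin n)) : ℝ :=
  (1 / 2) * ∑ k, berwald L k i j k u v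

/-- The angular form `h_ij = F F_{yⁱyʲ}`. -/
noncomputable def angularForm
    (L : EuclideanSpace ℝ (Fin n) → EuclideanSpace ℝ (Fin n) → ℝ) (i j : Fin n)
    (u v : EuclideanSpace ℝ (Fin n)) : ℝ :=
  L u v * dy i (dy j L) u v

end Local

/-! ### Finsler metrics on a smooth manifold -/

section Global

variable {n : ℕ} {M : Type*} [TopologicalSpace M] [ChartedSpace (EuclideanSpace ℝ (Fin n)) M]

/-- Finsler metrics: continuous functions on `TM`, smooth on the slit tangent bundle, which restrict
to a Minkowski norm on each tangent space. (As a vector space with a topology, `T_x M` is the model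
space `EuclideanSpace ℝ (Fin n)`; being a Minkowski norm does not depend on the linear coordinates
used.) -/
structure IsFinslerMetric [IsManifold (𝓡 n) ∞ M] (F : TangentBundle (𝓡 n) M → ℝ) : Prop where
  continuous : Continuous F
  smooth : ContMDiffOn (𝓡 n).tangent 𝓘(ℝ, ℝ) ∞ F {p | p.2 ≠ 0}
  minkowski : ∀ x : M, IsMinkowskiNorm (V := EuclideanSpace ℝ (Fin n)) (fun y => F ⟨x, y⟩)

/-- Isometries of `(M, F)`: the diffeomorphisms of `M` preserving `F`. -/
def IsIsometry (F : TangentBundle (𝓡 n) M → ℝ) (Φ : M ≃ₘ^∞⟮𝓡 n, 𝓡 n⟯ M) : Prop :=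
  ∀ (x : M) (y : TangentSpace (𝓡 n) x), F ⟨Φ x, mfderiv (𝓡 n) (𝓡 n) Φ x y⟩ = F ⟨x, y⟩

/-- `(M, F)` is homogeneous if its isometry group acts transitively on `M`. -/
def IsHomogeneous (F : TangentBundle (𝓡 n) M → ℝ) : Prop :=
  ∀ p q : M, ∃ Φ : M ≃ₘ^∞⟮𝓡 n, 𝓡 n⟯ M, IsIsometry F Φ ∧ Φ p = q

/-- Smooth linear sub-bundles of `TM` of rank `k`: near each point there are `k` smooth vector fields
forming a basis of the fibre at each point. -/
def IsSmoothSubbundle [IsManifold (𝓡 n) ∞ M] (k : ℕ)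
    (V : ∀ x : M, Submodule ℝ (TangentSpace (𝓡 n) x)) : Prop :=
  ∀ x : M, ∃ U : Set M, IsOpen U ∧ x ∈ U ∧ ∃ X : Fin k → ∀ p : M, TangentSpace (𝓡 n) p,
    (∀ a, ContMDiffOn (𝓡 n) (𝓡 n).tangent ∞
      (fun p => (⟨p, X a p⟩ : TangentBundle (𝓡 n) M)) U) ∧
    ∀ p ∈ U, LinearIndependent ℝ (fun a => X a p) ∧
      Submodule.span ℝ (Set.range fun a => X a p) = V p

/-- `(α₁, α₂)` metrics: Finsler metrics `F` for which there are a Riemannian metric `α` and an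
`α`-orthogonal decomposition `TM = V₁ + V₂` into two linear sub-bundles, such that `F y` depends only
on the lengths `α(y₁)` and `α(y₂)` of the two components of `y`. (Here `α.inner` is the squared
metric, so equal values of `α.inner` on the diagonal are equal `α`-lengths.) -/
def IsAlphaOneAlphaTwo [IsManifold (𝓡 n) ∞ M] (F : TangentBundle (𝓡 n) M → ℝ) : Prop :=
  IsFinslerMetric F ∧
  ∃ (α : Bundle.ContMDiffRiemannianMetric (𝓡 n) ∞ (EuclideanSpace ℝ (Fin n))
      (fun x : M => TangentSpace (𝓡 n) x))
    (n₁ n₂ : ℕ) (V₁ V₂ : ∀ x : M, Submodule ℝ (TangentSpace (𝓡 n) x)),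
    IsSmoothSubbundle n₁ V₁ ∧ IsSmoothSubbundle n₂ V₂ ∧
    (∀ x, IsCompl (V₁ x) (V₂ x)) ∧
    (∀ x, ∀ v ∈ V₁ x, ∀ w ∈ V₂ x, α.inner x v w = 0) ∧
    ∀ x, ∀ y₁ ∈ V₁ x, ∀ y₂ ∈ V₂ x, ∀ x', ∀ y₁' ∈ V₁ x', ∀ y₂' ∈ V₂ x',
      α.inner x y₁ y₁ = α.inner x' y₁' y₁' → α.inner x y₂ y₂ = α.inner x' y₂' y₂' →
      F ⟨x, y₁ + y₂⟩ = F ⟨x', y₁' + y₂'⟩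

/-- The expression `(u, v) ↦ F (vⁱ ∂_{xⁱ})` of `F` in the standard local coordinates of a chart. -/
noncomputable def coordExpr (F : TangentBundle (𝓡 n) M → ℝ)
    (φ : OpenPartialHomeomorph M (EuclideanSpace ℝ (Fin n)))
    (u v : EuclideanSpace ℝ (Fin n)) : ℝ :=
  F ⟨φ.symm u, mfderiv (𝓡 n) (𝓡 n) φ.symm u v⟩

/-- The coordinates `(yⁱ)` of the tangent vector `y = yⁱ ∂_{xⁱ}` at `x` in a chart. -/
noncomputable def coordVec (φ : OpenPartialHomeomorph M (EuclideanSpace ℝ (Fin n)))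
    (x : M) (y : TangentSpace (𝓡 n) x) : EuclideanSpace ℝ (Fin n) :=
  mfderiv (𝓡 n) (𝓡 n) φ x y

/-- The S-curvature `S(x, y)`, with respect to the Busemann–Hausdorff measure, computed in the
chart `φ` around `x`. -/
noncomputable def sCurvature (F : TangentBundle (𝓡 n) M → ℝ)
    (φ : OpenPartialHomeomorph M (EuclideanSpace ℝ (Fin n)))
    (x : M) (y : TangentSpace (𝓡 n) x) : ℝ :=
  localS (coordExpr F φ) (φ x) (coordVec φ x y)

/-- The components `E_ij(x, y)` of the E-curvature in the chart `φ` around `x`. -/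
noncomputable def eCurvature (F : TangentBundle (𝓡 n) M → ℝ)
    (φ : OpenPartialHomeomorph M (EuclideanSpace ℝ (Fin n)))
    (i j : Fin n) (x : M) (y : TangentSpace (𝓡 n) x) : ℝ :=
  localE (coordExpr F φ) i j (φ x) (coordVec φ x y)

/-- The components `h_ij(x, y)` of the angular form in the chart `φ` around `x`. -/
noncomputable def hForm (F : TangentBundle (𝓡 n) M → ℝ)
    (φ : OpenPartialHomeomorph M (EuclideanSpace ℝ (Fin n)))
    (i j : Fin n) (x : M) (y : TangentSpace (𝓡 n) x) : ℝ :=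
  angularForm (coordExpr F φ) i j (φ x) (coordVec φ x y)

/-- Weakly isotropic S-curvature: `S = (n+1) c(x) F + ε` for a function `c` and a one-form `ε`
on `M`, in all standard local coordinates. -/
def WeaklyIsotropicS (F : TangentBundle (𝓡 n) M → ℝ) : Prop :=
  ∃ (c : M → ℝ) (ε : ∀ x : M, TangentSpace (𝓡 n) x →ₗ[ℝ] ℝ),
    ∀ φ ∈ IsManifold.maximalAtlas (𝓡 n) ∞ M, ∀ x ∈ φ.source,
      ∀ y : TangentSpace (𝓡 n) x, y ≠ 0 →
        sCurvature F φ x y = ((n : ℝ) + 1) * c x * F ⟨x, y⟩ + ε x y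

/-- Vanishing S-curvature. -/
def VanishingS (F : TangentBundle (𝓡 n) M → ℝ) : Prop :=
  ∀ φ ∈ IsManifold.maximalAtlas (𝓡 n) ∞ M, ∀ x ∈ φ.source,
    ∀ y : TangentSpace (𝓡 n) x, y ≠ 0 → sCurvature F φ x y = 0

/-- Isotropic E-curvature: `E_ij = ((n+1)/2) c(x) F⁻¹ h_ij` for a function `c` on `M`, in all
standard local coordinates. -/
def IsotropicE (F : TangentBundle (𝓡 n) M → ℝ) : Prop :=
  ∃ c : M → ℝ,
    ∀ φ ∈ IsManifold.maximalAtlas (𝓡 n) ∞ M, ∀ x ∈ φ.source,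
      ∀ y : TangentSpace (𝓡 n) x, y ≠ 0 → ∀ i j : Fin n,
        eCurvature F φ i j x y = ((n : ℝ) + 1) / 2 * c x * (F ⟨x, y⟩)⁻¹ * hForm F φ i j x y

/-- Vanishing E-curvature. -/
def VanishingE (F : TangentBundle (𝓡 n) M → ℝ) : Prop :=
  ∀ φ ∈ IsManifold.maximalAtlas (𝓡 n) ∞ M, ∀ x ∈ φ.source,
    ∀ y : TangentSpace (𝓡 n) x, y ≠ 0 → ∀ i j : Fin n, eCurvature F φ i j x y = 0

end Global

end Finsler

namespace Finsler

/-! ### Jacobi's formula for the derivative of a determinant. -/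

section JacobiFormula

variable {ι : Type*} [Fintype ι] [DecidableEq ι]

/-! Two symmetries of an $(\alpha_1,\alpha_2)$ metric carry the argument.

Reversibility. The map $y\mapsto -y$ preserves both component lengths, so $F(-y)=F(y)$. Hence $S$
and $E_{ij}$ are odd in $y$, while $F$ and $h_{ij}$ are even. Comparing $y$ with $-y$ turns
isotropic E-curvature into $E=0$, and reduces weakly isotropic S-curvature to $S=\epsilon$, linear
in $y$.

Reflections. Smooth orthonormal frames of $\mathcal V_1,\mathcal V_2$ write $F$ locally as $f(A_u
v)$, with one Minkowski norm $f$ and linear isomorphisms $A_u$ depending smoothly on $u$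
(`exists_isMonochromaticOn`). The distortion is invariant under linear changes of variable
(`distortion_comp`), so $\tau(u,v)=\tau_f(A_uv)$. At a nonzero $w$ in one of the two summands,
$d\tau_f=0$: the direction $w$ is killed by homogeneity, and each direction orthogonal to $w$ inside
either summand is reversed by a reflection that preserves $f$ and fixes $w$
(`fderiv_distortion_eq_zero`). Therefore $S$ vanishes on $\mathcal V_1\cup\mathcal V_2$
(`localS_eq_zero_of_mem`).

A linear form vanishing on $\mathcal V_1$ and $\mathcal V_2$ is zero, which gives 1 → 2. For the
E-curvature, $S=\partial\mathbf G^m/\partial y^m-y^m\partial_m\ln\sigma$ (`localS_eq`) makes $2E$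
the vertical Hessian of $S$ (`localE_eq`). So 2 → 4 is immediate. Conversely, if $E=0$ then $S$ is
affine on lines avoiding the origin; it vanishes at $2v_1$ and $2v_2$, hence at their midpoint
$v_1+v_2$ (`localS_eq_zero`). -/

theorem hasDerivAt_det_of_eq_one {N : ℝ → Matrix ι ι ℝ} {N' : Matrix ι ι ℝ} {t : ℝ}
    (hN : ∀ i j, HasDerivAt (fun s => N s i j) (N' i j) t) (h1 : N t = 1) :
    HasDerivAt (fun s => (N s).det) N'.trace t := by
  simp only [Matrix.det_apply]
  have h : HasDerivAt (fun s => ∑ σ : Equiv.Perm ι, Equiv.Perm.sign σ • ∏ i, N s (σ i) i)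
      (∑ σ : Equiv.Perm ι, Equiv.Perm.sign σ •
        ∑ i, (∏ j ∈ Finset.univ.erase i, N t (σ j) j) • N' (σ i) i) t := by
    refine HasDerivAt.fun_sum fun σ _ => ?_
    have := HasDerivAt.fun_finsetProd (u := Finset.univ) (f := fun i s => N s (σ i) i)
      (f' := fun i => N' (σ i) i) (x := t) fun i _ => hN (σ i) i
    rcases Int.units_eq_one_or (Equiv.Perm.sign σ) with h | h <;> rw [h]
    · simpa using this
    · simpa [Units.smul_def] using this.fun_neg
  convert h using 1
  -- A nontrivial permutation moves at least two indices, so after one factor is differentiated an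
  -- off-diagonal entry of the identity matrix still remains and kills the product.
  rw [Finset.sum_eq_single 1]
  · simp [h1, Matrix.trace]
  · intro σ _ hσ
    rw [Finset.sum_eq_zero, smul_zero]
    intro i _
    obtain ⟨j, hj, hji⟩ : ∃ j, σ j ≠ j ∧ j ≠ i := by
      by_contra! hc
      obtain ⟨k, hk⟩ : ∃ k, σ k ≠ k := by
        by_contra! hc'
        exact hσ (Equiv.ext hc')
      have hki := hc k hk
      subst hki
      have := hc (σ k) (fun h => hk (σ.injective h))
      exact hk this
    rw [Finset.prod_eq_zero (i := j) (by simp [hji]) (by simp [h1, hj]), zero_smul]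
  · simp

/-- Normalising by the constant matrix `(N t)⁻¹` reduces to a curve through the identity. -/
theorem hasDerivAt_det {N : ℝ → Matrix ι ι ℝ} {N' : Matrix ι ι ℝ} {t : ℝ}
    (hN : ∀ i j, HasDerivAt (fun s => N s i j) (N' i j) t) (h0 : (N t).det ≠ 0) :
    HasDerivAt (fun s => (N s).det) ((N t).det * ((N t)⁻¹ * N').trace) t := by
  have hu : IsUnit (N t).det := isUnit_iff_ne_zero.2 h0
  have h := hasDerivAt_det_of_eq_one (N := fun s => (N t)⁻¹ * N s) (N' := (N t)⁻¹ * N') (t := t)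
    (fun i j => by
      simp only [Matrix.mul_apply]
      exact HasDerivAt.fun_sum fun k _ => (hN k j).const_mul _)
    (Matrix.nonsing_inv_mul _ hu)
  have h2 := h.const_mul (N t).det
  refine h2.congr_of_eventuallyEq (Filter.Eventually.of_forall fun s => ?_)
  simp only [Matrix.det_mul, Matrix.det_nonsing_inv, Ring.inverse_eq_inv']
  field_simp

theorem hasDerivAt_log_sqrt_det {N : ℝ → Matrix ι ι ℝ} {N' : Matrix ι ι ℝ} {t : ℝ}
    (hN : ∀ i j, HasDerivAt (fun s => N s i j) (N' i j) t) (h0 : 0 < (N t).det) :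
    HasDerivAt (fun s => Real.log (Real.sqrt (N s).det)) (1 / 2 * ((N t)⁻¹ * N').trace) t := by
  have h := ((hasDerivAt_det hN h0.ne').sqrt h0.ne').log (Real.sqrt_pos.2 h0).ne'
  convert h using 1
  have := Real.mul_self_sqrt h0.le
  have h3 := (Real.sqrt_pos.2 h0).ne'
  field_simp
  rw [pow_two, this]

end JacobiFormula

/-! ### Smooth functions on the slit tangent bundle and their partial derivatives. -/

section LocalCalculus

variable {n : ℕ}

/-- Functions of `(x, y)` which are smooth for `x ∈ U` and `y ≠ 0`. -/
def SlitSmooth (U : Set (EuclideanSpace ℝ (Fin n)))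
    (f : EuclideanSpace ℝ (Fin n) → EuclideanSpace ℝ (Fin n) → ℝ) : Prop :=
  ContDiffOn ℝ ∞ (Function.uncurry f) (U ×ˢ {0}ᶜ)

variable {U : Set (EuclideanSpace ℝ (Fin n))}
  {f g : EuclideanSpace ℝ (Fin n) → EuclideanSpace ℝ (Fin n) → ℝ} {u v : EuclideanSpace ℝ (Fin n)}

theorem isOpen_slit (hU : IsOpen U) : IsOpen (U ×ˢ ({0}ᶜ : Set (EuclideanSpace ℝ (Fin n)))) :=
  hU.prod isOpen_compl_singleton

theorem SlitSmooth.contDiffAt (hU : IsOpen U) (hf : SlitSmooth U f) (hu : u ∈ U) (hv : v ≠ 0) :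
    ContDiffAt ℝ ∞ (Function.uncurry f) (u, v) :=
  ContDiffOn.contDiffAt hf ((isOpen_slit hU).mem_nhds ⟨hu, hv⟩)

theorem SlitSmooth.differentiableAt (hU : IsOpen U) (hf : SlitSmooth U f) (hu : u ∈ U)
    (hv : v ≠ 0) : DifferentiableAt ℝ (Function.uncurry f) (u, v) :=
  (hf.contDiffAt hU hu hv).differentiableAt (by simp)

theorem SlitSmooth.hasLineDerivAt_fst (hU : IsOpen U) (hf : SlitSmooth U f) (hu : u ∈ U)
    (hv : v ≠ 0) (e : EuclideanSpace ℝ (Fin n)) : HasLineDerivAt ℝ (fun w => f w v)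
      (fderiv ℝ (Function.uncurry f) (u, v) (e, 0)) u e := by
  have h := (hf.differentiableAt hU hu hv).hasFDerivAt.hasLineDerivAt (e, 0)
  simpa [HasLineDerivAt, Function.uncurry] using h

theorem SlitSmooth.hasLineDerivAt_snd (hU : IsOpen U) (hf : SlitSmooth U f) (hu : u ∈ U)
    (hv : v ≠ 0) (e : EuclideanSpace ℝ (Fin n)) : HasLineDerivAt ℝ (fun w => f u w)
      (fderiv ℝ (Function.uncurry f) (u, v) (0, e)) v e := by
  have h := (hf.differentiableAt hU hu hv).hasFDerivAt.hasLineDerivAt (0, e)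
  simpa [HasLineDerivAt, Function.uncurry] using h

theorem SlitSmooth.dx_eq (hU : IsOpen U) (hf : SlitSmooth U f) (hu : u ∈ U) (hv : v ≠ 0)
    (i : Fin n) : dx i f u v =
      fderiv ℝ (Function.uncurry f) (u, v) (EuclideanSpace.single i 1, 0) :=
  (hf.hasLineDerivAt_fst hU hu hv _).lineDeriv

theorem SlitSmooth.dy_eq (hU : IsOpen U) (hf : SlitSmooth U f) (hu : u ∈ U) (hv : v ≠ 0)
    (i : Fin n) : dy i f u v =
      fderiv ℝ (Function.uncurry f) (u, v) (0, EuclideanSpace.single i 1) :=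
  (hf.hasLineDerivAt_snd hU hu hv _).lineDeriv

theorem SlitSmooth.hasDerivAt_dx (hU : IsOpen U) (hf : SlitSmooth U f) (hu : u ∈ U) (hv : v ≠ 0)
    (i : Fin n) : HasDerivAt (fun t : ℝ => f (u + t • EuclideanSpace.single i 1) v)
      (dx i f u v) 0 := by
  rw [hf.dx_eq hU hu hv]
  exact hf.hasLineDerivAt_fst hU hu hv _

theorem SlitSmooth.hasDerivAt_dy (hU : IsOpen U) (hf : SlitSmooth U f) (hu : u ∈ U) (hv : v ≠ 0)
    (i : Fin n) : HasDerivAt (fun t : ℝ => f u (v + t • EuclideanSpace.single i 1))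
      (dy i f u v) 0 := by
  rw [hf.dy_eq hU hu hv]
  exact hf.hasLineDerivAt_snd hU hu hv _

theorem SlitSmooth.congr (hf : SlitSmooth U f) (h : ∀ u ∈ U, ∀ v ≠ 0, g u v = f u v) :
    SlitSmooth U g :=
  ContDiffOn.congr hf fun p hp => h p.1 hp.1 p.2 hp.2

theorem SlitSmooth.fderiv_apply (hU : IsOpen U) (hf : SlitSmooth U f) (e : EuclideanSpace ℝ (Fin n) × EuclideanSpace ℝ (Fin n)) :
    SlitSmooth U (fun u v => fderiv ℝ (Function.uncurry f) (u, v) e) := by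
  have h := ContDiffOn.fderiv_of_isOpen (m := ∞) hf (isOpen_slit hU) (by simp)
  exact h.clm_apply contDiffOn_const

theorem SlitSmooth.dx (hU : IsOpen U) (hf : SlitSmooth U f) (i : Fin n) :
    SlitSmooth U (dx i f) :=
  (hf.fderiv_apply hU (EuclideanSpace.single i 1, 0)).congr fun _ hu _ hv => hf.dx_eq hU hu hv i

theorem SlitSmooth.dy (hU : IsOpen U) (hf : SlitSmooth U f) (i : Fin n) :
    SlitSmooth U (dy i f) :=
  (hf.fderiv_apply hU (0, EuclideanSpace.single i 1)).congr fun _ hu _ hv => hf.dy_eq hU hu hv i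

theorem dx_congr (hU : IsOpen U) (h : ∀ u ∈ U, ∀ v ≠ 0, g u v = f u v) (hu : u ∈ U) (hv : v ≠ 0)
    (i : Fin n) : dx i g u v = dx i f u v :=
  Filter.EventuallyEq.lineDeriv_eq
    (Filter.eventually_of_mem (hU.mem_nhds hu) fun w hw => h w hw v hv)

theorem dy_congr (h : ∀ v ≠ 0, g u v = f u v) (hv : v ≠ 0)
    (i : Fin n) : dy i g u v = dy i f u v :=
  Filter.EventuallyEq.lineDeriv_eq
    (Filter.eventually_of_mem (isOpen_compl_singleton.mem_nhds hv) fun w hw => h w hw)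

theorem SlitSmooth.fderiv_fderiv_comm (hU : IsOpen U) (hf : SlitSmooth U f) (hu : u ∈ U)
    (hv : v ≠ 0) (a b : EuclideanSpace ℝ (Fin n) × EuclideanSpace ℝ (Fin n)) :
    fderiv ℝ (Function.uncurry fun u v => fderiv ℝ (Function.uncurry f) (u, v) a) (u, v) b =
    fderiv ℝ (Function.uncurry fun u v => fderiv ℝ (Function.uncurry f) (u, v) b) (u, v) a := by
  have hc := hf.contDiffAt hU hu hv
  have hs := hc.isSymmSndFDerivAt (by
    rw [minSmoothness_of_isRCLikeNormedField]
    exact WithTop.coe_le_coe.2 (le_top : (2 : ℕ∞) ≤ ⊤))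
  have hd : DifferentiableAt ℝ (fderiv ℝ (Function.uncurry f)) (u, v) :=
    (hc.fderiv_right (m := 1) (by norm_cast)).differentiableAt (by simp)
  have key : ∀ a b : EuclideanSpace ℝ (Fin n) × (EuclideanSpace ℝ (Fin n)),
      fderiv ℝ (Function.uncurry fun u v => fderiv ℝ (Function.uncurry f) (u, v) a) (u, v) b =
      fderiv ℝ (fderiv ℝ (Function.uncurry f)) (u, v) b a := by
    intro a b
    have : (Function.uncurry fun u v => fderiv ℝ (Function.uncurry f) (u, v) a) =
      fun p => fderiv ℝ (Function.uncurry f) p a := rfl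
    rw [this, fderiv_clm_apply hd (by fun_prop)]
    simp
  rw [key, key, hs.eq]

theorem SlitSmooth.dy_dy_comm (hU : IsOpen U) (hf : SlitSmooth U f) (hu : u ∈ U)
    (hv : v ≠ 0) (i j : Fin n) : Finsler.dy i (Finsler.dy j f) u v =
      Finsler.dy j (Finsler.dy i f) u v := by
  rw [dy_congr (f := fun u v => fderiv ℝ (Function.uncurry f) (u, v) (0, EuclideanSpace.single j 1))
      (fun v hv => hf.dy_eq hU hu hv j) hv,
    dy_congr (f := fun u v => fderiv ℝ (Function.uncurry f) (u, v) (0, EuclideanSpace.single i 1))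
      (fun v hv => hf.dy_eq hU hu hv i) hv,
    (hf.fderiv_apply hU _).dy_eq hU hu hv, (hf.fderiv_apply hU _).dy_eq hU hu hv,
    hf.fderiv_fderiv_comm hU hu hv]

theorem SlitSmooth.dy_dx_comm (hU : IsOpen U) (hf : SlitSmooth U f) (hu : u ∈ U)
    (hv : v ≠ 0) (i j : Fin n) : Finsler.dy i (Finsler.dx j f) u v =
      Finsler.dx j (Finsler.dy i f) u v := by
  rw [dy_congr (f := fun u v => fderiv ℝ (Function.uncurry f) (u, v) (EuclideanSpace.single j 1, 0))
      (fun v hv => hf.dx_eq hU hu hv j) hv,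
    dx_congr (f := fun u v => fderiv ℝ (Function.uncurry f) (u, v) (0, EuclideanSpace.single i 1))
      hU (fun u hu v hv => hf.dy_eq hU hu hv i) hu hv,
    (hf.fderiv_apply hU _).dy_eq hU hu hv, (hf.fderiv_apply hU _).dx_eq hU hu hv,
    hf.fderiv_fderiv_comm hU hu hv]

theorem SlitSmooth.sub (hf : SlitSmooth U f) (hg : SlitSmooth U g) :
    SlitSmooth U (fun u v => f u v - g u v) := ContDiffOn.sub hf hg

theorem SlitSmooth.mul (hf : SlitSmooth U f) (hg : SlitSmooth U g) :
    SlitSmooth U (fun u v => f u v * g u v) := ContDiffOn.mul hf hg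

theorem SlitSmooth.pow (hf : SlitSmooth U f) (k : ℕ) :
    SlitSmooth U (fun u v => f u v ^ k) := ContDiffOn.pow hf k

theorem SlitSmooth.const (c : ℝ) : SlitSmooth U (fun _ _ => c) := contDiffOn_const

theorem SlitSmooth.coord (i : Fin n) : SlitSmooth U (fun _ v => v i) := by
  have : ContDiff ℝ ∞ (fun p : EuclideanSpace ℝ (Fin n) × EuclideanSpace ℝ (Fin n) => p.2 i) := by fun_prop
  exact this.contDiffOn

theorem SlitSmooth.sum {ι : Type*} {s : Finset ι} {F : ι → EuclideanSpace ℝ (Fin n) → EuclideanSpace ℝ (Fin n) → ℝ}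
    (h : ∀ a ∈ s, SlitSmooth U (F a)) : SlitSmooth U (fun u v => ∑ a ∈ s, F a u v) :=
  ContDiffOn.sum (f := fun a => Function.uncurry (F a)) h

theorem SlitSmooth.inv (hf : SlitSmooth U f) (h0 : ∀ u ∈ U, ∀ v ≠ 0, f u v ≠ 0) :
    SlitSmooth U (fun u v => (f u v)⁻¹) :=
  ContDiffOn.inv hf fun p hp => h0 p.1 hp.1 p.2 hp.2

theorem SlitSmooth.det {ι : Type*} [Fintype ι] [DecidableEq ι] {M : EuclideanSpace ℝ (Fin n) → EuclideanSpace ℝ (Fin n) → Matrix ι ι ℝ}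
    (hM : ∀ i j, SlitSmooth U (fun u v => M u v i j)) : SlitSmooth U (fun u v => (M u v).det) := by
  simp only [Matrix.det_apply']
  exact .sum fun σ _ => (SlitSmooth.const _).mul
    (contDiffOn_prod (t := Finset.univ) (s := U ×ˢ {0}ᶜ)
      (f := fun i (p : EuclideanSpace ℝ (Fin n) × EuclideanSpace ℝ (Fin n)) =>
        M p.1 p.2 (σ i) i) fun i _ => hM (σ i) i)

theorem SlitSmooth.matrix_inv {ι : Type*} [Fintype ι] [DecidableEq ι] {M : EuclideanSpace ℝ (Fin n) → EuclideanSpace ℝ (Fin n) → Matrix ι ι ℝ}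
    (hM : ∀ i j, SlitSmooth U (fun u v => M u v i j))
    (h0 : ∀ u ∈ U, ∀ v ≠ 0, (M u v).det ≠ 0) (i j : ι) :
    SlitSmooth U (fun u v => (M u v)⁻¹ i j) := by
  -- Cramer's rule expresses the entries of the inverse through determinants, whose smoothness is
  -- known.
  have : ∀ u v, (M u v)⁻¹ i j = ((M u v).det)⁻¹ * ((M u v).updateRow j (Pi.single i 1)).det := by
    intro u v
    rw [Matrix.inv_def, Matrix.smul_apply, Matrix.adjugate_apply, Ring.inverse_eq_inv', smul_eq_mul]
  simp only [this]
  refine ((SlitSmooth.det hM).inv h0).mul (.det fun a b => ?_)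
  by_cases h : a = j
  · subst h
    simpa using SlitSmooth.const _
  · simpa [Matrix.updateRow_apply, h] using hM a b

end LocalCalculus

/-! ### S-curvature and E-curvature through the spray coefficients. -/

section SCurvatureFormula

variable {n : ℕ}

variable {U : Set (EuclideanSpace ℝ (Fin n))} {L : EuclideanSpace ℝ (Fin n) → EuclideanSpace ℝ (Fin n) → ℝ} {u v : EuclideanSpace ℝ (Fin n)}

theorem SlitSmooth.gMatrix (hU : IsOpen U) (hL : SlitSmooth U L) (i j : Fin n) :
    SlitSmooth U (fun u v => gMatrix L u v i j) :=
  (SlitSmooth.const _).mul (((hL.pow 2).dy hU j).dy hU i)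

/-- The right hand side `[F²]_{xᵏyˡ} yᵏ - [F²]_{xˡ}` of the equation for the spray coefficients. -/
noncomputable def sprayForce (L : EuclideanSpace ℝ (Fin n) → EuclideanSpace ℝ (Fin n) → ℝ) (l : Fin n) (u v : EuclideanSpace ℝ (Fin n)) : ℝ :=
  (∑ k, dx k (dy l (fun p w => L p w ^ 2)) u v * v k) - dx l (fun p w => L p w ^ 2) u v

theorem SlitSmooth.sprayForce (hU : IsOpen U) (hL : SlitSmooth U L) (l : Fin n) :
    SlitSmooth U (sprayForce L l) :=
  (SlitSmooth.sum fun k _ => (((hL.pow 2).dy hU l).dx hU k).mul (.coord k)).sub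
    ((hL.pow 2).dx hU l)

theorem SlitSmooth.sprayCoeff (hU : IsOpen U) (hL : SlitSmooth U L)
    (h0 : ∀ u ∈ U, ∀ v ≠ 0, 0 < (Finsler.gMatrix L u v).det) (i : Fin n) :
    SlitSmooth U (sprayCoeff L i) :=
  (SlitSmooth.const _).mul (.sum fun l _ =>
    (SlitSmooth.matrix_inv (hL.gMatrix hU) (fun u hu v hv => (h0 u hu v hv).ne') i l).mul
      (hL.sprayForce hU l))

/-- Lowering the index gives an equation free of the inverse matrix, which can be differentiated by
the product rule alone. -/
theorem gMatrix_mul_sprayCoeff (h0 : (gMatrix L u v).det ≠ 0) (i : Fin n) :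
    ∑ l, gMatrix L u v i l * sprayCoeff L l u v = 1 / 4 * sprayForce L i u v := by
  have h1 : (fun l => sprayCoeff L l u v) =
      (1 / 4 : ℝ) • ((gMatrix L u v)⁻¹).mulVec (fun l => sprayForce L l u v) := by
    ext l
    simp [sprayCoeff, sprayForce, Matrix.mulVec, dotProduct]
  have h2 : (gMatrix L u v).mulVec (fun l => sprayCoeff L l u v) =
      (1 / 4 : ℝ) • (fun l => sprayForce L l u v) := by
    rw [h1, Matrix.mulVec_smul, Matrix.mulVec_mulVec,
      Matrix.mul_nonsing_inv _ (isUnit_iff_ne_zero.2 h0), Matrix.one_mulVec]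
  simpa [Matrix.mulVec, dotProduct] using congrFun h2 i

/-- The last two terms are antisymmetric in `i`, `j` and disappear on symmetrising. -/
theorem dy_sprayForce (hU : IsOpen U) (hL : SlitSmooth U L) (hu : u ∈ U) (hv : v ≠ 0)
    (i j : Fin n) : dy j (sprayForce L i) u v =
      2 * ∑ k, v k * dx k (fun u v => gMatrix L u v j i) u v
        + dx j (dy i (fun p w => L p w ^ 2)) u v - dx i (dy j (fun p w => L p w ^ 2)) u v := by
  have hP := hL.pow 2
  have hc : ∀ k : Fin n, HasDerivAt
      (fun t : ℝ => (v + t • EuclideanSpace.single j (1 : ℝ)) k) (if k = j then 1 else 0) 0 := by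
    intro k
    have : HasDerivAt (fun t : ℝ => v k + t * (if k = j then 1 else 0))
        (if k = j then 1 else 0) 0 := by
      simpa using ((hasDerivAt_id (0 : ℝ)).mul_const (if k = j then (1 : ℝ) else 0)).const_add (v k)
    simpa [PiLp.single_apply] using this
  have h : HasDerivAt (fun t : ℝ => sprayForce L i u (v + t • EuclideanSpace.single j 1))
      (∑ k, (dy j (dx k (dy i (fun p w => L p w ^ 2))) u v * v k +
          dx k (dy i (fun p w => L p w ^ 2)) u v * (if k = j then 1 else 0))
        - dy j (dx i (fun p w => L p w ^ 2)) u v) 0 := by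
    refine HasDerivAt.fun_sub (HasDerivAt.fun_sum fun k _ => ?_) ((hP.dx hU i).hasDerivAt_dy hU hu hv j)
    simpa using (((hP.dy hU i).dx hU k).hasDerivAt_dy hU hu hv j).fun_mul (hc k)
  rw [((hL.sprayForce hU i).hasDerivAt_dy hU hu hv j).unique h, hP.dy_dx_comm hU hu hv,
    Finset.sum_add_distrib]
  have hg : ∀ k, dx k (fun u v => gMatrix L u v j i) u v =
      1 / 2 * dx k (dy j (dy i (fun p w => L p w ^ 2))) u v := by
    intro k
    refine HasDerivAt.unique ((hL.gMatrix hU j i).hasDerivAt_dx hU hu hv k) ?_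
    exact ((((hP.dy hU i).dy hU j).hasDerivAt_dx hU hu hv k).const_mul _)
  simp only [hg, mul_ite, mul_one, mul_zero, Finset.sum_ite_eq', Finset.mem_univ, if_true,
    Finset.mul_sum, (hP.dy hU i).dy_dx_comm hU hu hv]
  congr 2
  exact Finset.sum_congr rfl fun k _ => by ring

theorem gMatrix_symm (hU : IsOpen U) (hL : SlitSmooth U L) (hu : u ∈ U) (hv : v ≠ 0)
    (i j : Fin n) : gMatrix L u v i j = gMatrix L u v j i := by
  simp only [gMatrix, Matrix.of_apply, (hL.pow 2).dy_dy_comm hU hu hv i j]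

theorem dy_gMatrix (hU : IsOpen U) (hL : SlitSmooth U L) (hu : u ∈ U) (hv : v ≠ 0)
    (i j k : Fin n) : dy k (fun u v => gMatrix L u v i j) u v =
      1 / 2 * dy k (dy i (dy j (fun p w => L p w ^ 2))) u v :=
  HasDerivAt.unique ((hL.gMatrix hU i j).hasDerivAt_dy hU hu hv k)
    (((((hL.pow 2).dy hU j).dy hU i).hasDerivAt_dy hU hu hv k).const_mul _)

/-- Total symmetry of the Cartan tensor: third vertical derivatives of $F^2$ commute. -/
theorem dy_gMatrix_comm (hU : IsOpen U) (hL : SlitSmooth U L) (hu : u ∈ U) (hv : v ≠ 0)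
    (i j k : Fin n) : dy k (fun u v => gMatrix L u v i j) u v =
      dy i (fun u v => gMatrix L u v k j) u v := by
  rw [dy_gMatrix hU hL hu hv, dy_gMatrix hU hL hu hv,
    ((hL.pow 2).dy hU j).dy_dy_comm hU hu hv]

theorem dx_gMatrix_symm (hU : IsOpen U) (hL : SlitSmooth U L) (hu : u ∈ U) (hv : v ≠ 0)
    (i j k : Fin n) : dx k (fun u v => gMatrix L u v i j) u v =
      dx k (fun u v => gMatrix L u v j i) u v :=
  dx_congr hU (fun _ hu _ hv => gMatrix_symm hU hL hu hv i j) hu hv k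

theorem dy_gMatrix_symm (hU : IsOpen U) (hL : SlitSmooth U L) (hu : u ∈ U) (hv : v ≠ 0)
    (i j k : Fin n) : dy k (fun u v => gMatrix L u v i j) u v =
      dy k (fun u v => gMatrix L u v j i) u v :=
  dy_congr (fun _ hv => gMatrix_symm hU hL hu hv i j) hv k

/-- The derivative of the fundamental tensor along the geodesic spray. -/
theorem spray_gMatrix (hU : IsOpen U) (hL : SlitSmooth U L)
    (h0 : ∀ u ∈ U, ∀ v ≠ 0, 0 < (gMatrix L u v).det) (hu : u ∈ U) (hv : v ≠ 0) (i j : Fin n) :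
    ∑ k, (v k * dx k (fun u v => gMatrix L u v i j) u v -
        2 * sprayCoeff L k u v * dy k (fun u v => gMatrix L u v i j) u v) =
      ∑ l, (gMatrix L u v i l * dy j (sprayCoeff L l) u v +
        gMatrix L u v j l * dy i (sprayCoeff L l) u v) := by
  have key : ∀ i j : Fin n, ∑ l, (dy l (fun u v => gMatrix L u v i j) u v * sprayCoeff L l u v +
      gMatrix L u v i l * dy j (sprayCoeff L l) u v) = 1 / 4 * dy j (sprayForce L i) u v := by
    intro i j
    have h1 : HasDerivAt (fun t : ℝ => ∑ l, gMatrix L u (v + t • EuclideanSpace.single j 1) i l *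
        sprayCoeff L l u (v + t • EuclideanSpace.single j 1))
        (∑ l, (dy j (fun u v => gMatrix L u v i l) u v * sprayCoeff L l u v +
          gMatrix L u v i l * dy j (sprayCoeff L l) u v)) 0 := by
      refine HasDerivAt.fun_sum fun l _ => ?_
      simpa using ((hL.gMatrix hU i l).hasDerivAt_dy hU hu hv j).fun_mul
        ((hL.sprayCoeff hU h0 l).hasDerivAt_dy hU hu hv j)
    have h2 := ((hL.sprayForce hU i).hasDerivAt_dy hU hu hv j).const_mul (1 / 4)
    have hne : ∀ᶠ t in nhds (0 : ℝ), v + t • EuclideanSpace.single j (1 : ℝ) ≠ 0 := by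
      have hcont : Continuous fun t : ℝ => v + t • EuclideanSpace.single j (1 : ℝ) := by fun_prop
      exact hcont.continuousAt.eventually_ne (by simpa using hv)
    have h3 := h1.unique (h2.congr_of_eventuallyEq (hne.mono fun t ht =>
      gMatrix_mul_sprayCoeff (h0 u hu _ ht).ne' i))
    rw [← h3]
    refine Finset.sum_congr rfl fun l _ => ?_
    rw [dy_gMatrix_symm hU hL hu hv i l, dy_gMatrix_comm hU hL hu hv l i j,
      dy_gMatrix_symm hU hL hu hv j i]
  -- Adding the two index orders cancels the antisymmetric mixed derivatives and leaves the
  -- horizontal and vertical derivatives of $g_{ij}$.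
  have e1 := key i j
  have e2 := key j i
  rw [dy_sprayForce hU hL hu hv] at e1 e2
  simp only [dx_gMatrix_symm hU hL hu hv j i, dy_gMatrix_symm hU hL hu hv j i] at e1 e2
  rw [Finset.sum_add_distrib] at e1 e2
  rw [Finset.sum_sub_distrib, Finset.sum_add_distrib]
  have e3 : ∑ k, 2 * sprayCoeff L k u v * dy k (fun u v => gMatrix L u v i j) u v =
      2 * ∑ k, dy k (fun u v => gMatrix L u v i j) u v * sprayCoeff L k u v := by
    rw [Finset.mul_sum]
    exact Finset.sum_congr rfl fun k _ => by ring
  rw [e3]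
  linarith

theorem distortion_eq (h0 : 0 < (gMatrix L u v).det) (hσ : 0 < bhDensity L u) :
    distortion L u v =
      Real.log (Real.sqrt (gMatrix L u v).det) - Real.log (bhDensity L u) :=
  Real.log_div (Real.sqrt_pos.2 h0).ne' hσ.ne'

theorem dx_distortion (hU : IsOpen U) (hL : SlitSmooth U L)
    (h0 : ∀ u ∈ U, ∀ v ≠ 0, 0 < (gMatrix L u v).det)
    (hσ : ∀ u ∈ U, 0 < bhDensity L u) (hσ' : DifferentiableAt ℝ (bhDensity L) u)
    (hu : u ∈ U) (hv : v ≠ 0) (k : Fin n) :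
    dx k (distortion L) u v = 1 / 2 * ((gMatrix L u v)⁻¹ *
      Matrix.of fun i j => dx k (fun u v => gMatrix L u v i j) u v).trace -
      lineDeriv ℝ (fun p => Real.log (bhDensity L p)) u (EuclideanSpace.single k 1) := by
  rw [dx_congr (f := fun u v => Real.log (Real.sqrt (gMatrix L u v).det) -
    Real.log (bhDensity L u)) hU
    (fun u hu v hv => distortion_eq (h0 u hu v hv) (hσ u hu)) hu hv]
  have h1 := hasDerivAt_log_sqrt_det (t := 0)
    (N := fun t : ℝ => gMatrix L (u + t • EuclideanSpace.single k 1) v)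
    (N' := Matrix.of fun i j => dx k (fun u v => gMatrix L u v i j) u v)
    (fun i j => (hL.gMatrix hU i j).hasDerivAt_dx hU hu hv k) (by simpa using h0 u hu v hv)
  have h2 := ((hσ'.log (hσ u hu).ne').lineDifferentiableAt
    (v := EuclideanSpace.single k 1)).hasLineDerivAt
  simp only [zero_smul, add_zero] at h1
  exact (HasDerivAt.fun_sub h1 h2).deriv

theorem dy_distortion (hU : IsOpen U) (hL : SlitSmooth U L)
    (h0 : ∀ u ∈ U, ∀ v ≠ 0, 0 < (gMatrix L u v).det)
    (hσ : ∀ u ∈ U, 0 < bhDensity L u) (hu : u ∈ U) (hv : v ≠ 0) (k : Fin n) :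
    dy k (distortion L) u v = 1 / 2 * ((gMatrix L u v)⁻¹ *
      Matrix.of fun i j => dy k (fun u v => gMatrix L u v i j) u v).trace := by
  rw [dy_congr (f := fun u v => Real.log (Real.sqrt (gMatrix L u v).det) -
    Real.log (bhDensity L u)) (fun v hv => distortion_eq (h0 u hu v hv) (hσ u hu)) hv]
  have h1 := hasDerivAt_log_sqrt_det (t := 0)
    (N := fun t : ℝ => gMatrix L u (v + t • EuclideanSpace.single k 1))
    (N' := Matrix.of fun i j => dy k (fun u v => gMatrix L u v i j) u v)
    (fun i j => (hL.gMatrix hU i j).hasDerivAt_dy hU hu hv k) (by simpa using h0 u hu v hv)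
  simp only [zero_smul, add_zero] at h1
  exact (HasDerivAt.sub_const _ h1).deriv

theorem trace_inv_mul_add_transpose {g N : Matrix (Fin n) (Fin n) ℝ} (hg : g.transpose = g)
    (hdet : IsUnit g.det) : (g⁻¹ * (g * N + (g * N).transpose)).trace = 2 * N.trace := by
  rw [Matrix.mul_add, Matrix.trace_add, ← Matrix.mul_assoc, Matrix.nonsing_inv_mul _ hdet,
    Matrix.transpose_mul, hg, Matrix.trace_mul_comm g⁻¹, Matrix.mul_assoc,
    Matrix.mul_nonsing_inv _ hdet]
  simp only [Matrix.one_mul, Matrix.mul_one, Matrix.trace_transpose]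
  ring

/-- The S-curvature in terms of the spray coefficients:
`S = ∂Gᵐ/∂yᵐ - yᵐ ∂(ln σ)/∂xᵐ`. -/
theorem localS_eq (hU : IsOpen U) (hL : SlitSmooth U L)
    (h0 : ∀ u ∈ U, ∀ v ≠ 0, 0 < (gMatrix L u v).det)
    (hσ : ∀ u ∈ U, 0 < bhDensity L u) (hσ' : DifferentiableAt ℝ (bhDensity L) u)
    (hu : u ∈ U) (hv : v ≠ 0) :
    localS L u v = ∑ m, dy m (sprayCoeff L m) u v -
      ∑ m, v m * lineDeriv ℝ (fun p => Real.log (bhDensity L p)) u (EuclideanSpace.single m 1) := by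
  -- In matrix form, the spray derivative of $g$ is $gN+(gN)^T$ with $N=(\partial\mathbf
  -- G^l/\partial y^j)$. Jacobi's formula for $\ln\sqrt{\det g}$ then yields exactly
  -- $\operatorname{tr}N$.
  have hmat : ∑ k, (v k • (Matrix.of fun i j => dx k (fun u v => gMatrix L u v i j) u v) -
      (2 * sprayCoeff L k u v) • Matrix.of fun i j => dy k (fun u v => gMatrix L u v i j) u v) =
      gMatrix L u v * (Matrix.of fun l j => dy j (sprayCoeff L l) u v) +
      (gMatrix L u v * (Matrix.of fun l j => dy j (sprayCoeff L l) u v)).transpose := by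
    ext i j
    have h := spray_gMatrix hU hL h0 hu hv i j
    rw [Finset.sum_add_distrib] at h
    rw [Matrix.sum_apply, Matrix.add_apply, Matrix.transpose_apply, Matrix.mul_apply,
      Matrix.mul_apply]
    exact h
  have htr := trace_inv_mul_add_transpose (g := gMatrix L u v)
    (N := Matrix.of fun l j => dy j (sprayCoeff L l) u v)
    (Matrix.ext fun i j => gMatrix_symm hU hL hu hv j i)
    (isUnit_iff_ne_zero.2 (h0 u hu v hv).ne')
  rw [← hmat, Matrix.mul_sum, Matrix.trace_sum] at htr
  have hN : (Matrix.of fun l j => dy j (sprayCoeff L l) u v).trace =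
    ∑ m, dy m (sprayCoeff L m) u v := rfl
  rw [hN] at htr
  rw [localS]
  simp only [dx_distortion hU hL h0 hσ hσ' hu hv, dy_distortion hU hL h0 hσ hu hv]
  have h2 : ∑ m, dy m (sprayCoeff L m) u v =
      1 / 2 * (2 * ∑ m, dy m (sprayCoeff L m) u v) := by ring
  rw [h2, ← htr, Finset.mul_sum, ← Finset.sum_sub_distrib]
  refine Finset.sum_congr rfl fun k _ => ?_
  rw [Matrix.mul_sub, Matrix.trace_sub, Matrix.mul_smul, Matrix.mul_smul, Matrix.trace_smul,
    Matrix.trace_smul, smul_eq_mul, smul_eq_mul]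
  ring

theorem dy_linear (ξ : Fin n → ℝ) (j : Fin n) :
    dy j (fun _ v => ∑ m, v m * ξ m) u v = ξ j := by
  refine HasDerivAt.deriv ?_
  have : HasDerivAt (fun t : ℝ => (∑ m, v m * ξ m) + t * ξ j) (ξ j) 0 := by
    simpa using ((hasDerivAt_id (0 : ℝ)).mul_const (ξ j)).const_add (∑ m, v m * ξ m)
  refine this.congr_of_eventuallyEq (Filter.Eventually.of_forall fun t => ?_)
  simp [PiLp.single_apply, add_mul, Finset.sum_add_distrib]

/-- The E-curvature is half the vertical Hessian of the S-curvature. -/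
theorem localE_eq (hU : IsOpen U) (hL : SlitSmooth U L)
    (h0 : ∀ u ∈ U, ∀ v ≠ 0, 0 < (gMatrix L u v).det)
    (hσ : ∀ u ∈ U, 0 < bhDensity L u) (hσ' : ∀ u ∈ U, DifferentiableAt ℝ (bhDensity L) u)
    (hu : u ∈ U) (hv : v ≠ 0) (i j : Fin n) :
    localE L i j u v = 1 / 2 * dy i (dy j (localS L)) u v := by
  have hG := hL.sprayCoeff hU h0
  -- The density depends on the base point only, so its contribution to $S$ is linear in $y$ and
  -- dies under two vertical derivatives.
  set ξ : Fin n → ℝ := fun m =>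
    lineDeriv ℝ (fun p => Real.log (bhDensity L p)) u (EuclideanSpace.single m 1)
  have h1 : ∀ v ≠ 0, dy j (localS L) u v = ∑ m, dy j (dy m (sprayCoeff L m)) u v - ξ j := by
    intro v hv
    rw [dy_congr (f := fun u v => ∑ m, dy m (sprayCoeff L m) u v - ∑ m, v m * ξ m)
      (fun v hv => localS_eq hU hL h0 hσ (hσ' u hu) hu hv) hv]
    refine HasDerivAt.deriv (HasDerivAt.fun_sub (HasDerivAt.fun_sum fun m _ =>
      ((hG m).dy hU m).hasDerivAt_dy hU hu hv j) ?_)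
    have hlin : SlitSmooth U (fun _ v => ∑ m, v m * ξ m) :=
      .sum fun m _ => (SlitSmooth.coord m).mul (.const _)
    have := hlin.hasDerivAt_dy hU hu hv j
    rwa [dy_linear] at this
  have h2 : dy i (dy j (localS L)) u v = ∑ m, dy i (dy j (dy m (sprayCoeff L m))) u v := by
    rw [dy_congr (f := fun u v => ∑ m, dy j (dy m (sprayCoeff L m)) u v - ξ j) h1 hv]
    refine HasDerivAt.deriv (HasDerivAt.sub_const _ (HasDerivAt.fun_sum fun m _ =>
      (((hG m).dy hU m).dy hU j).hasDerivAt_dy hU hu hv i))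
  rw [h2, localE]
  rfl

theorem SlitSmooth.localS (hU : IsOpen U) (hL : SlitSmooth U L)
    (h0 : ∀ u ∈ U, ∀ v ≠ 0, 0 < (Finsler.gMatrix L u v).det)
    (hd : SlitSmooth U (distortion L)) : SlitSmooth U (localS L) :=
  .sum fun k _ => ((SlitSmooth.coord k).mul (hd.dx hU k)).sub
    (((SlitSmooth.const 2).mul (hL.sprayCoeff hU h0 k)).mul (hd.dy hU k))

end SCurvatureFormula

/-! ### Behaviour of the fundamental tensor, volume density and distortion under linear maps. -/

section LinearChange

variable {n : ℕ} {f : EuclideanSpace ℝ (Fin n) → ℝ}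
  {A : EuclideanSpace ℝ (Fin n) →L[ℝ] (EuclideanSpace ℝ (Fin n))}
  {p v w : EuclideanSpace ℝ (Fin n)}

theorem hasFDerivAt_of_contDiffOn_compl_zero {P : EuclideanSpace ℝ (Fin n) → ℝ}
    (hP : ContDiffOn ℝ ∞ P {0}ᶜ) (hw : w ≠ 0) : HasFDerivAt P (fderiv ℝ P w) w :=
  ((hP.contDiffAt (isOpen_compl_singleton.mem_nhds hw)).differentiableAt (by simp)).hasFDerivAt

theorem hasFDerivAt_fderiv_of_contDiffOn_compl_zero {P : EuclideanSpace ℝ (Fin n) → ℝ}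
    (hP : ContDiffOn ℝ ∞ P {0}ᶜ) (hw : w ≠ 0) :
    HasFDerivAt (fderiv ℝ P) (fderiv ℝ (fderiv ℝ P) w) w :=
  (((hP.contDiffAt (isOpen_compl_singleton.mem_nhds hw)).fderiv_right
    (m := 1) (by norm_cast)).differentiableAt (by simp)).hasFDerivAt

theorem lineDeriv_lineDeriv_comp {P : EuclideanSpace ℝ (Fin n) → ℝ}
    (hP : ContDiffOn ℝ ∞ P {0}ᶜ) (hA : Function.Injective A) (hv : v ≠ 0)
    (a b : EuclideanSpace ℝ (Fin n)) :
    lineDeriv ℝ (fun w => lineDeriv ℝ (fun w => P (A w)) w a) v b =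
      fderiv ℝ (fderiv ℝ P) (A v) (A b) (A a) := by
  have hA0 : ∀ w ≠ 0, A w ≠ 0 := fun w hw h => hw (hA (by simpa using h))
  have h1 : ∀ w ≠ 0, lineDeriv ℝ (fun w => P (A w)) w a = fderiv ℝ P (A w) (A a) := by
    intro w hw
    have h := (hasFDerivAt_of_contDiffOn_compl_zero hP (hA0 w hw)).comp w A.hasFDerivAt
    exact (h.hasLineDerivAt a).lineDeriv
  have h2 : (fun w => lineDeriv ℝ (fun w => P (A w)) w a) =ᶠ[nhds v]
      fun w => fderiv ℝ P (A w) (A a) :=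
    Filter.eventually_of_mem (isOpen_compl_singleton.mem_nhds hv) h1
  rw [h2.lineDeriv_eq]
  have h3 := (hasFDerivAt_fderiv_of_contDiffOn_compl_zero hP (hA0 v hv)).comp v A.hasFDerivAt
  have h4 := h3.clm_apply (hasFDerivAt_const (A a) v)
  exact ((h4.hasLineDerivAt b).lineDeriv).trans (by simp)

theorem gMatrix_comp_apply (hf : ContDiffOn ℝ ∞ f {0}ᶜ) (hA : Function.Injective A) (hv : v ≠ 0)
    (i j : Fin n) : gMatrix (fun _ w => f (A w)) p v i j =
      1 / 2 * fderiv ℝ (fderiv ℝ fun w => f w ^ 2) (A v) (A (EuclideanSpace.single i 1))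
        (A (EuclideanSpace.single j 1)) := by
  have := lineDeriv_lineDeriv_comp (hf.pow 2) hA hv (EuclideanSpace.single j 1)
    (EuclideanSpace.single i 1)
  simpa [gMatrix, dy] using this

theorem gMatrix_apply (hf : ContDiffOn ℝ ∞ f {0}ᶜ) (hv : v ≠ 0) (i j : Fin n) :
    gMatrix (fun _ => f) p v i j =
      1 / 2 * fderiv ℝ (fderiv ℝ fun w => f w ^ 2) v (EuclideanSpace.single i 1)
        (EuclideanSpace.single j 1) :=
  gMatrix_comp_apply (A := .id ℝ _) hf Function.injective_id hv i j

theorem fderiv_fderiv_eq_gMatrix (hf : ContDiffOn ℝ ∞ f {0}ᶜ) (hv : v ≠ 0)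
    (a b : EuclideanSpace ℝ (Fin n)) :
    1 / 2 * fderiv ℝ (fderiv ℝ fun w => f w ^ 2) v a b =
      ∑ i, ∑ j, a i * gMatrix (fun _ => f) p v i j * b j := by
  have ha : ∀ a : EuclideanSpace ℝ (Fin n), a = ∑ i, a i • EuclideanSpace.single i (1 : ℝ) := by
    intro a
    simpa using ((EuclideanSpace.basisFun (Fin n) ℝ).sum_repr a).symm
  simp only [gMatrix_apply hf hv]
  conv_lhs => rw [ha a, ha b]
  simp only [map_sum, map_smul, _root_.sum_apply, _root_.smul_apply,
    smul_eq_mul, Finset.mul_sum]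
  rw [Finset.sum_comm]
  exact Finset.sum_congr rfl fun i _ => Finset.sum_congr rfl fun j _ => by ring

theorem gMatrix_comp (hf : ContDiffOn ℝ ∞ f {0}ᶜ) (hA : Function.Injective A) (hv : v ≠ 0) :
    gMatrix (fun _ w => f (A w)) p v =
      (LinearMap.toMatrix (EuclideanSpace.basisFun (Fin n) ℝ).toBasis
        (EuclideanSpace.basisFun (Fin n) ℝ).toBasis A.toLinearMap).transpose *
      gMatrix (fun _ => f) p (A v) *
      LinearMap.toMatrix (EuclideanSpace.basisFun (Fin n) ℝ).toBasis
        (EuclideanSpace.basisFun (Fin n) ℝ).toBasis A.toLinearMap := by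
  have hAv : A v ≠ 0 := fun h => hv (hA (by simpa using h))
  ext i j
  rw [gMatrix_comp_apply hf hA hv, fderiv_fderiv_eq_gMatrix (p := p) hf hAv, Finset.sum_comm]
  simp [Matrix.mul_apply, LinearMap.toMatrix_apply, Finset.sum_mul]

theorem det_gMatrix_comp (hf : ContDiffOn ℝ ∞ f {0}ᶜ) (hA : Function.Injective A) (hv : v ≠ 0) :
    (gMatrix (fun _ w => f (A w)) p v).det =
      LinearMap.det A.toLinearMap ^ 2 * (gMatrix (fun _ => f) p (A v)).det := by
  rw [gMatrix_comp hf hA hv, Matrix.det_mul, Matrix.det_mul, Matrix.det_transpose,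
    LinearMap.det_toMatrix]
  ring

theorem det_ne_zero_of_injective (hA : Function.Injective A) :
    LinearMap.det A.toLinearMap ≠ 0 := by
  intro h
  have := LinearMap.bot_lt_ker_of_det_eq_zero h
  rw [LinearMap.ker_eq_bot.2 hA] at this
  exact lt_irrefl _ this

/-- The unit ball of `f ∘ A` is the preimage under `A` of that of `f`, so its volume is divided by
$|\det A|$. -/
theorem bhDensity_comp (hA : Function.Injective A) :
    bhDensity (fun _ w => f (A w)) p =
      |LinearMap.det A.toLinearMap| * bhDensity (fun _ => f) p := by
  have h : {w | f (A w) < 1} = A ⁻¹' {w | f w < 1} := rfl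
  rw [bhDensity, bhDensity, h, MeasureTheory.measureReal_def MeasureTheory.volume (A ⁻¹' _),
    MeasureTheory.Measure.addHaar_preimage_continuousLinearMap _ (det_ne_zero_of_injective hA),
    ENNReal.toReal_mul, ENNReal.toReal_ofReal (abs_nonneg _), abs_inv,
    ← MeasureTheory.measureReal_def]
  field_simp

/-- $\sqrt{\det g}$ and $\sigma$ both acquire the factor $|\det A|$, which cancels in the quotient.
-/
theorem distortion_comp (hf : ContDiffOn ℝ ∞ f {0}ᶜ) (hA : Function.Injective A) (hv : v ≠ 0) :
    distortion (fun _ w => f (A w)) p v = distortion (fun _ => f) p (A v) := by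
  have h0 := det_ne_zero_of_injective hA
  rw [distortion, distortion, det_gMatrix_comp hf hA hv, bhDensity_comp hA,
    Real.sqrt_mul (sq_nonneg _), Real.sqrt_sq_eq_abs, mul_div_mul_left _ _ (abs_ne_zero.2 h0)]

/-- Second derivatives of a 2-homogeneous function are 0-homogeneous: the linear change `A = c • id`
multiplies $f^2$ by $c^2$ and the Hessian arguments by the same factor. -/
theorem gMatrix_smul_apply {c : ℝ} (hc : 0 < c) (hf : ContDiffOn ℝ ∞ f {0}ᶜ)
    (hhom : ∀ (c : ℝ) w, 0 ≤ c → f (c • w) = c * f w) (hv : v ≠ 0) :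
    gMatrix (fun _ => f) p (c • v) = gMatrix (fun _ => f) p v := by
  ext i j
  have hA : Function.Injective
      (c • ContinuousLinearMap.id ℝ (EuclideanSpace ℝ (Fin n))) := by
    intro a b hab
    exact (smul_right_injective _ hc.ne') (by simpa using hab)
  have h1 := gMatrix_comp_apply (p := p) hf hA hv i j
  have h2 : (fun w => f ((c • ContinuousLinearMap.id ℝ (EuclideanSpace ℝ (Fin n))) w)) =
      fun w => c * f w := by
    ext w
    simpa using hhom c w hc.le
  have h3 : gMatrix (fun _ w => c * f w) p v i j = c ^ 2 * gMatrix (fun _ => f) p v i j := by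
    simp only [gMatrix, dy, lineDeriv, Matrix.of_apply, mul_pow, deriv_const_mul_field]
    ring
  rw [h2, h3] at h1
  simp only [_root_.smul_apply, ContinuousLinearMap.id_apply, map_smul,
    smul_eq_mul] at h1
  have hcv : c • v ≠ 0 := smul_ne_zero hc.ne' hv
  rw [gMatrix_apply (p := p) hf hcv]
  have hc2 : c ^ 2 ≠ 0 := by positivity
  apply mul_left_cancel₀ hc2
  rw [h1]
  ring

theorem fundamentalTensor_self (hf : ContDiffOn ℝ ∞ f {0}ᶜ) (hv : v ≠ 0)
    (a : EuclideanSpace ℝ (Fin n)) : fundamentalTensor f v a a =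
      1 / 2 * fderiv ℝ (fderiv ℝ fun w => f w ^ 2) v a a := by
  have h := lineDeriv_lineDeriv_comp (A := .id ℝ _) (hf.pow 2) Function.injective_id hv a a
  simp only [ContinuousLinearMap.id_apply] at h
  rw [← h]
  rfl

theorem gMatrix_posDef (hf : IsMinkowskiNorm f) (hv : v ≠ 0) :
    (gMatrix (fun _ => f) p v).PosDef := by
  have hs : ContDiffOn ℝ ∞ f {0}ᶜ := hf.smooth
  refine Matrix.PosDef.of_dotProduct_mulVec_pos ?_ fun x hx => ?_
  · ext i j
    have hL : SlitSmooth Set.univ (fun _ : EuclideanSpace ℝ (Fin n) => f) :=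
      hs.comp (t := {0}ᶜ) contDiff_snd.contDiffOn fun q hq => hq.2
    simpa using gMatrix_symm isOpen_univ hL (Set.mem_univ p) hv j i
  · have h := hf.stronglyConvex v hv (WithLp.toLp 2 x)
      (fun h => hx (by simpa using congrArg WithLp.ofLp h))
    rw [fundamentalTensor_self hs hv, fderiv_fderiv_eq_gMatrix (p := p) hs hv] at h
    simpa [dotProduct, Matrix.mulVec, Finset.mul_sum, mul_assoc] using h

theorem IsMinkowskiNorm.exists_pos_mul_norm_le (hf : IsMinkowskiNorm f) :
    ∃ m > 0, ∀ w, m * ‖w‖ ≤ f w := by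
  -- The sphere is empty in dimension 0, where every vector is zero; otherwise compactness gives a
  -- positive minimum of `f` on it.
  rcases (Metric.sphere (0 : EuclideanSpace ℝ (Fin n)) 1).eq_empty_or_nonempty with he | hne
  · refine ⟨1, one_pos, fun w => ?_⟩
    by_cases hw : w = 0
    · simp [hw, hf.nonneg]
    · exfalso
      have : (‖w‖⁻¹ • w) ∈ Metric.sphere (0 : EuclideanSpace ℝ (Fin n)) 1 := by
        simp [norm_smul, hw]
      simp [he] at this
  · obtain ⟨z, hz, hmin⟩ := (isCompact_sphere _ _).exists_isMinOn hne hf.continuous.continuousOn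
    have hz0 : z ≠ 0 := by
      rintro rfl
      simp at hz
    refine ⟨f z, hf.pos z hz0, fun w => ?_⟩
    by_cases hw : w = 0
    · simp [hw, hf.nonneg]
    · have h1 : f z ≤ f (‖w‖⁻¹ • w) := hmin (by simp [norm_smul, hw])
      rw [hf.homogeneous _ _ (by positivity)] at h1
      have h2 : 0 < ‖w‖ := norm_pos_iff.2 hw
      field_simp at h1
      linarith

/-- The unit ball of `f` is open, contains 0, and is bounded by the lower bound `m * ‖w‖ ≤ f w`, so
its volume is positive and finite. -/
theorem bhDensity_pos (hf : IsMinkowskiNorm f) : 0 < bhDensity (fun _ => f) p := by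
  have h0 : f 0 = 0 := by simpa using hf.homogeneous 0 0 le_rfl
  obtain ⟨m, hm, hle⟩ := hf.exists_pos_mul_norm_le
  have hb : {w | f w < 1} ⊆ Metric.closedBall 0 m⁻¹ := by
    intro w hw
    have h1 : m * ‖w‖ < 1 := (hle w).trans_lt hw
    rw [mem_closedBall_zero_iff, ← one_div, le_div_iff₀ hm]
    linarith
  have ho : IsOpen {w | f w < 1} := isOpen_lt hf.continuous continuous_const
  refine div_pos ?_ ?_
  · exact ENNReal.toReal_pos (Metric.measure_ball_pos _ _ one_pos).ne'
      MeasureTheory.measure_ball_lt_top.ne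
  · exact ENNReal.toReal_pos (ho.measure_pos _ ⟨0, by simp [h0]⟩).ne'
      ((MeasureTheory.measure_mono hb).trans_lt
        (Metric.isBounded_closedBall.measure_lt_top)).ne

theorem distortion_slitSmooth (hf : IsMinkowskiNorm f) :
    ContDiffOn ℝ ∞ (distortion (fun _ => f) p) {0}ᶜ := by
  have hL : SlitSmooth Set.univ (fun _ : EuclideanSpace ℝ (Fin n) => f) :=
    ContDiffOn.comp (t := {0}ᶜ) hf.smooth contDiff_snd.contDiffOn fun q hq => hq.2
  have hd := SlitSmooth.det (hL.gMatrix isOpen_univ)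
  have hd' : ContDiffOn ℝ ∞ (fun v => (gMatrix (fun _ => f) p v).det) {0}ᶜ :=
    ContDiffOn.comp (g := Function.uncurry fun u v => (gMatrix (fun _ => f) u v).det)
      (f := fun v => (p, v)) hd (contDiff_const.prodMk contDiff_id).contDiffOn
      fun v hv => ⟨Set.mem_univ _, hv⟩
  have hpos : ∀ v ∈ ({0}ᶜ : Set (EuclideanSpace ℝ (Fin n))),
      0 < (gMatrix (fun _ => f) p v).det := fun v hv => (gMatrix_posDef hf hv).det_pos
  refine ((hd'.sqrt fun v hv => (hpos v hv).ne').div_const _).log fun v hv => ?_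
  exact (div_pos (Real.sqrt_pos.2 (hpos v hv)) (bhDensity_pos hf)).ne'

end LinearChange

/-! ### Critical points of the distortion forced by reflections and homogeneity. -/

section Symmetry

variable {n : ℕ} {f : EuclideanSpace ℝ (Fin n) → ℝ}
  {b : EuclideanSpace ℝ (Fin n) →L[ℝ] (EuclideanSpace ℝ (Fin n)) →L[ℝ] ℝ}
  {W₁ W₂ : Submodule ℝ (EuclideanSpace ℝ (Fin n))}
  {p w : EuclideanSpace ℝ (Fin n)}

/-- A function `f` of `y = y₁ + y₂`, with `y₁ ∈ W₁` and `y₂ ∈ W₂`, depending only on the lengths of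
`y₁` and `y₂` for a scalar product making `W₁` and `W₂` orthogonal. -/
structure DependsOnLengths (f : EuclideanSpace ℝ (Fin n) → ℝ)
    (b : EuclideanSpace ℝ (Fin n) →L[ℝ] (EuclideanSpace ℝ (Fin n)) →L[ℝ] ℝ)
    (W₁ W₂ : Submodule ℝ (EuclideanSpace ℝ (Fin n))) : Prop where
  symm : ∀ v w, b v w = b w v
  pos : ∀ v, v ≠ 0 → 0 < b v v
  isCompl : IsCompl W₁ W₂
  orthogonal : ∀ v ∈ W₁, ∀ w ∈ W₂, b v w = 0
  eq_of_length_eq : ∀ y₁ ∈ W₁, ∀ y₂ ∈ W₂, ∀ y₁' ∈ W₁, ∀ y₂' ∈ W₂,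
    b y₁ y₁ = b y₁' y₁' → b y₂ y₂ = b y₂' y₂' → f (y₁ + y₂) = f (y₁' + y₂')

theorem DependsOnLengths.swap (h : DependsOnLengths f b W₁ W₂) : DependsOnLengths f b W₂ W₁ where
  symm := h.symm
  pos := h.pos
  isCompl := h.isCompl.symm
  orthogonal v hv w hw := by rw [h.symm, h.orthogonal w hw v hv]
  eq_of_length_eq y₁ hy₁ y₂ hy₂ y₁' hy₁' y₂' hy₂' h₁ h₂ := by
    rw [add_comm y₁, add_comm y₁']
    exact h.eq_of_length_eq y₂ hy₂ y₁ hy₁ y₂' hy₂' y₁' hy₁' h₂ h₁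

theorem exists_add_eq_of_isCompl (h : IsCompl W₁ W₂) (y : EuclideanSpace ℝ (Fin n)) :
    ∃ y₁ ∈ W₁, ∃ y₂ ∈ W₂, y₁ + y₂ = y :=
  Submodule.mem_sup.1 (by simp [h.sup_eq_top])

/-- The reflection reversing `e` preserves `f`, hence the distortion, and fixes `w`. The
differential at `w` therefore takes equal values on `e` and `-e`. -/
theorem DependsOnLengths.fderiv_distortion_apply_eq_zero_left (h : DependsOnLengths f b W₁ W₂)
    (hf : IsMinkowskiNorm f) (hw : w ≠ 0) {e : EuclideanSpace ℝ (Fin n)} (he : e ∈ W₁)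
    (hew : b e w = 0) : fderiv ℝ (distortion (fun _ => f) p) w e = 0 := by
  by_cases he0 : e = 0
  · simp [he0]
  have hee := h.pos e he0
  -- The `b`-orthogonal reflection in the hyperplane orthogonal to `e`. As `e ∈ W₁`, it acts on the
  -- `W₁`-component isometrically and leaves the `W₂`-component alone.
  set R : EuclideanSpace ℝ (Fin n) →L[ℝ] (EuclideanSpace ℝ (Fin n)) :=
    .id ℝ _ - (2 / b e e) • (b e).smulRight e with hR
  have hRapply : ∀ y, R y = y - (2 / b e e * b e y) • e := by
    intro y
    simp [hR, smul_smul]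
  have hRR : ∀ y, R (R y) = y := by
    intro y
    rw [hRapply (R y), hRapply y]
    simp only [map_sub, map_smul, smul_eq_mul, sub_sub, ← add_smul]
    rw [sub_eq_self]
    convert zero_smul ℝ e using 2
    field_simp
    ring
  have hRinj : Function.Injective R := Function.LeftInverse.injective hRR
  have hfR : ∀ y, f (R y) = f y := by
    intro y
    obtain ⟨y₁, hy₁, y₂, hy₂, rfl⟩ := exists_add_eq_of_isCompl h.isCompl y
    have h1 : R (y₁ + y₂) = (y₁ - (2 / b e e * b e y₁) • e) + y₂ := by
      rw [hRapply, map_add, h.orthogonal e he y₂ hy₂, add_zero]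
      abel
    rw [h1]
    refine h.eq_of_length_eq _ (W₁.sub_mem hy₁ (W₁.smul_mem _ he)) _ hy₂ _ hy₁ _ hy₂ ?_ rfl
    simp only [map_sub, map_smul, _root_.sub_apply, _root_.smul_apply,
      smul_eq_mul, h.symm y₁ e]
    field_simp
    ring
  have hRw : R w = w := by simp [hRapply, hew]
  have hRe : R e = -e := by
    rw [hRapply, div_mul_cancel₀ _ hee.ne', two_smul]
    abel
  have hd : ∀ v ≠ 0, distortion (fun _ => f) p (R v) = distortion (fun _ => f) p v := by
    intro v hv
    rw [← distortion_comp hf.smooth hRinj hv]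
    simp only [hfR]
  have hdiff := hasFDerivAt_of_contDiffOn_compl_zero (distortion_slitSmooth (p := p) hf) hw
  have hdiff' := hdiff
  rw [← hRw] at hdiff'
  have h1 := hdiff'.comp w R.hasFDerivAt
  have h2 := h1.congr_of_eventuallyEq (f₁ := distortion (fun _ => f) p)
    (Filter.eventually_of_mem (isOpen_compl_singleton.mem_nhds hw) fun v hv => (hd v hv).symm)
  have h3 := congrArg (fun T => T e) (hdiff.unique h2)
  simp only [ContinuousLinearMap.comp_apply, hRe, hRw, map_neg] at h3
  linarith

/-- Euler's relation: the distortion is constant along rays because the fundamental tensor is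
0-homogeneous. -/
theorem fderiv_distortion_apply_self (hf : IsMinkowskiNorm f) (hw : w ≠ 0) :
    fderiv ℝ (distortion (fun _ => f) p) w w = 0 := by
  have hdiff := hasFDerivAt_of_contDiffOn_compl_zero (distortion_slitSmooth (p := p) hf) hw
  have h1 := hdiff.hasLineDerivAt w
  refine h1.unique ((hasDerivAt_const (0 : ℝ) (distortion (fun _ => f) p w)).congr_of_eventuallyEq ?_)
  filter_upwards [lt_mem_nhds (show (-1 : ℝ) < 0 by norm_num)] with t ht
  have h2 : w + t • w = (1 + t) • w := by rw [add_smul, one_smul]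
  rw [h2, distortion, distortion, gMatrix_smul_apply (by linarith) hf.smooth hf.homogeneous hw]

theorem DependsOnLengths.fderiv_distortion_eq_zero_left (h : DependsOnLengths f b W₁ W₂)
    (hf : IsMinkowskiNorm f) (hw : w ≠ 0) (hw₁ : w ∈ W₁) :
    fderiv ℝ (distortion (fun _ => f) p) w = 0 := by
  ext y
  obtain ⟨y₁, hy₁, y₂, hy₂, rfl⟩ := exists_add_eq_of_isCompl h.isCompl y
  have hww := h.pos w hw
  -- Split into the radial direction, a vector of `W₁` orthogonal to `w`, and a vector of `W₂`, the
  -- last being orthogonal to `w` automatically.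
  have h1 : y₁ + y₂ = (b w y₁ / b w w) • w + (y₁ - (b w y₁ / b w w) • w) + y₂ := by abel
  rw [h1, map_add, map_add, map_smul, fderiv_distortion_apply_self hf hw,
    h.fderiv_distortion_apply_eq_zero_left hf hw (W₁.sub_mem hy₁ (W₁.smul_mem _ hw₁)),
    h.swap.fderiv_distortion_apply_eq_zero_left hf hw hy₂]
  · simp
  · rw [h.symm, h.orthogonal w hw₁ y₂ hy₂]
  · rw [h.symm]
    simp only [map_sub, map_smul, smul_eq_mul]
    field_simp
    ring

theorem DependsOnLengths.fderiv_distortion_eq_zero (h : DependsOnLengths f b W₁ W₂)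
    (hf : IsMinkowskiNorm f) (hw : w ≠ 0) (hw' : w ∈ W₁ ∨ w ∈ W₂) :
    fderiv ℝ (distortion (fun _ => f) p) w = 0 :=
  hw'.elim (h.fderiv_distortion_eq_zero_left hf hw) (h.swap.fderiv_distortion_eq_zero_left hf hw)

end Symmetry

/-! ### Parity in $y$ of the curvatures of a reversible metric. -/

section Parity

variable {n : ℕ} {L f : EuclideanSpace ℝ (Fin n) → EuclideanSpace ℝ (Fin n) → ℝ}

/-- Functions of `(x, y)` which are multiplied by `ε` when `y` is replaced by `-y`. -/
def HasParity (ε : ℝ) (f : EuclideanSpace ℝ (Fin n) → EuclideanSpace ℝ (Fin n) → ℝ) : Prop :=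
  ∀ u v, f u (-v) = ε * f u v

/-- No smoothness is needed here or for `dy`: `deriv` commutes with constant factors and with `t ↦
-t` even at points where it takes its default value. -/
theorem HasParity.dx {ε : ℝ} (h : HasParity ε f) (i : Fin n) : HasParity ε (dx i f) := by
  intro u v
  have h1 : (fun w => f w (-v)) = fun w => ε * f w v := funext fun w => h w v
  rw [Finsler.dx, h1]
  simp only [lineDeriv, deriv_const_mul_field]
  rfl

theorem HasParity.dy {ε : ℝ} (h : HasParity ε f) (i : Fin n) : HasParity (-ε) (dy i f) := by
  intro u v
  have h1 : (fun t : ℝ => f u (-v + t • EuclideanSpace.single i 1)) =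
      fun t : ℝ => ε * (fun s : ℝ => f u (v + s • EuclideanSpace.single i 1)) (-t) := by
    ext t
    rw [← h]
    congr 1
    simp only [neg_smul]
    abel
  have h2 : Finsler.dy i f u (-v) =
      deriv (fun t : ℝ => f u (-v + t • EuclideanSpace.single i 1)) 0 := rfl
  rw [h2, h1, deriv_const_mul_field,
    deriv_comp_neg (fun s : ℝ => f u (v + s • EuclideanSpace.single i 1)), neg_zero]
  simp only [Finsler.dy, lineDeriv]
  ring

theorem HasParity.sq (h : HasParity 1 L) : HasParity 1 (fun u v => L u v ^ 2) := by
  intro u v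
  simp only [h u v, one_mul]

theorem HasParity.gMatrix_neg (h : HasParity 1 L) (u v : EuclideanSpace ℝ (Fin n)) :
    gMatrix L u (-v) = gMatrix L u v := by
  ext i j
  simp only [gMatrix, Matrix.of_apply, ((h.sq.dy j).dy i) u v]
  ring

theorem HasParity.sprayCoeff (h : HasParity 1 L) (i : Fin n) : HasParity 1 (sprayCoeff L i) := by
  intro u v
  simp only [Finsler.sprayCoeff, h.gMatrix_neg, h.sq.dx _ u v, (h.sq.dy _).dx _ u v, PiLp.neg_apply]
  simp

theorem HasParity.distortion (h : HasParity 1 L) : HasParity 1 (distortion L) := by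
  intro u v
  simp only [Finsler.distortion, h.gMatrix_neg, one_mul]

/-- In each summand exactly one factor is odd: `v i` in the horizontal part, the vertical derivative
of the distortion in the other. -/
theorem HasParity.localS (h : HasParity 1 L) : HasParity (-1) (localS L) := by
  intro u v
  simp only [Finsler.localS, h.distortion.dx _ u v, h.distortion.dy _ u v, h.sprayCoeff _ u v,
    PiLp.neg_apply, Finset.mul_sum]
  exact Finset.sum_congr rfl fun i _ => by ring

/-- Three vertical derivatives of the even spray coefficients. -/
theorem HasParity.localE (h : HasParity 1 L) (i j : Fin n) : HasParity (-1) (localE L i j) := by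
  intro u v
  have h1 : ∀ k, berwald L k i j k u (-v) = -(-(-1)) * berwald L k i j k u v := fun k =>
    ((((h.sprayCoeff k).dy k).dy j).dy i) u v
  simp only [Finsler.localE, h1, ← Finset.mul_sum]
  ring

theorem HasParity.angularForm (h : HasParity 1 L) (i j : Fin n) :
    HasParity 1 (angularForm L i j) := by
  intro u v
  simp only [Finsler.angularForm, h u v, ((h.dy j).dy i) u v]
  ring

end Parity

/-! ### Vanishing of the S-curvature for metrics of the form $f(A_u v)$. -/

section LocalForm

variable {n : ℕ} {L : EuclideanSpace ℝ (Fin n) → EuclideanSpace ℝ (Fin n) → ℝ}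
  {f : EuclideanSpace ℝ (Fin n) → ℝ}
  {A : EuclideanSpace ℝ (Fin n) → EuclideanSpace ℝ (Fin n) →L[ℝ] (EuclideanSpace ℝ (Fin n))}
  {U : Set (EuclideanSpace ℝ (Fin n))}
  {b : EuclideanSpace ℝ (Fin n) →L[ℝ] (EuclideanSpace ℝ (Fin n)) →L[ℝ] ℝ}
  {W₁ W₂ : Submodule ℝ (EuclideanSpace ℝ (Fin n))}
  {u v : EuclideanSpace ℝ (Fin n)}

/-- A Finsler metric is monochromatic on `U` if, up to linear isomorphisms depending smoothly on the
point, it is a fixed Minkowski norm. -/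
structure IsMonochromaticOn
    (L : EuclideanSpace ℝ (Fin n) → EuclideanSpace ℝ (Fin n) → ℝ)
    (f : EuclideanSpace ℝ (Fin n) → ℝ)
    (A : EuclideanSpace ℝ (Fin n) → EuclideanSpace ℝ (Fin n) →L[ℝ] (EuclideanSpace ℝ (Fin n)))
    (U : Set (EuclideanSpace ℝ (Fin n))) : Prop where
  isOpen : IsOpen U
  minkowski : IsMinkowskiNorm f
  smooth : ContDiffOn ℝ ∞ A U
  injective : ∀ u ∈ U, Function.Injective (A u)
  eq : ∀ u ∈ U, ∀ v, L u v = f (A u v)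

namespace IsMonochromaticOn

theorem apply_ne_zero (h : IsMonochromaticOn L f A U) (hu : u ∈ U) (hv : v ≠ 0) : A u v ≠ 0 :=
  fun h0 => hv (h.injective u hu (by simpa using h0))

theorem slitSmooth_comp (h : IsMonochromaticOn L f A U) {t : EuclideanSpace ℝ (Fin n) → ℝ}
    (ht : ContDiffOn ℝ ∞ t {0}ᶜ) : SlitSmooth U (fun u v => t (A u v)) := by
  have h1 : ContDiffOn ℝ ∞
      (fun q : EuclideanSpace ℝ (Fin n) × EuclideanSpace ℝ (Fin n) => A q.1 q.2)
      (U ×ˢ {0}ᶜ) :=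
    (h.smooth.comp contDiff_fst.contDiffOn fun q hq => hq.1).clm_apply contDiff_snd.contDiffOn
  exact ht.comp h1 fun q hq => h.apply_ne_zero hq.1 hq.2

theorem slitSmooth (h : IsMonochromaticOn L f A U) : SlitSmooth U L :=
  (h.slitSmooth_comp h.minkowski.smooth).congr fun u hu v _ => h.eq u hu v

theorem eq_fun (h : IsMonochromaticOn L f A U) (hu : u ∈ U) : L u = fun v => f (A u v) :=
  funext (h.eq u hu)

theorem det_gMatrix_pos (h : IsMonochromaticOn L f A U) (hu : u ∈ U) (hv : v ≠ 0) :
    0 < (gMatrix L u v).det := by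
  have h1 : gMatrix L u v = gMatrix (fun _ => L u) u v := rfl
  rw [h1, h.eq_fun hu, det_gMatrix_comp h.minkowski.smooth (h.injective u hu) hv]
  exact mul_pos (sq_pos_of_ne_zero (det_ne_zero_of_injective (h.injective u hu)))
    (gMatrix_posDef h.minkowski (h.apply_ne_zero hu hv)).det_pos

theorem bhDensity_eq (h : IsMonochromaticOn L f A U) (hu : u ∈ U) :
    bhDensity L u = |LinearMap.det (A u).toLinearMap| * bhDensity (fun _ => f) 0 := by
  have h1 : bhDensity L u = bhDensity (fun _ => L u) u := rfl
  rw [h1, h.eq_fun hu, bhDensity_comp (h.injective u hu)]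
  rfl

theorem bhDensity_pos (h : IsMonochromaticOn L f A U) (hu : u ∈ U) : 0 < bhDensity L u := by
  rw [h.bhDensity_eq hu]
  exact mul_pos (abs_pos.2 (det_ne_zero_of_injective (h.injective u hu)))
    (Finsler.bhDensity_pos h.minkowski)

theorem differentiableAt_bhDensity (h : IsMonochromaticOn L f A U) (hu : u ∈ U) :
    DifferentiableAt ℝ (bhDensity L) u := by
  -- The density is a constant times $|\det A_u|$, and the determinant is a polynomial in the matrix
  -- entries; it never vanishes, so the absolute value does no harm.
  have hdet : ContDiffOn ℝ ∞ (fun u => LinearMap.det (A u).toLinearMap) U := by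
    simp only [← LinearMap.det_toMatrix (EuclideanSpace.basisFun (Fin n) ℝ).toBasis,
      Matrix.det_apply', LinearMap.toMatrix_apply]
    simp only [OrthonormalBasis.coe_toBasis, EuclideanSpace.basisFun_apply,
      OrthonormalBasis.coe_toBasis_repr_apply, EuclideanSpace.basisFun_repr]
    refine ContDiffOn.sum fun σ _ => contDiffOn_const.mul ?_
    refine contDiffOn_prod (t := Finset.univ)
      (f := fun i u => A u (EuclideanSpace.single i 1) (σ i)) fun i _ => ?_
    exact contDiffOn_euclidean.1 (h.smooth.clm_apply contDiffOn_const) (σ i)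
  have hdet := (hdet.contDiffAt (h.isOpen.mem_nhds hu)).differentiableAt (by simp)
  have h1 := (hdet.abs (det_ne_zero_of_injective (h.injective u hu))).mul_const
    (bhDensity (fun _ => f) 0)
  exact h1.congr_of_eventuallyEq
    (Filter.eventually_of_mem (h.isOpen.mem_nhds hu) fun w hw => h.bhDensity_eq hw)

theorem distortion_eq (h : IsMonochromaticOn L f A U) (hu : u ∈ U) (hv : v ≠ 0) :
    distortion L u v = distortion (fun _ => f) 0 (A u v) := by
  have h1 : distortion L u v = distortion (fun _ => L u) u v := rfl
  rw [h1, h.eq_fun hu, distortion_comp h.minkowski.smooth (h.injective u hu) hv]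
  rfl

theorem slitSmooth_distortion (h : IsMonochromaticOn L f A U) : SlitSmooth U (distortion L) :=
  (h.slitSmooth_comp (distortion_slitSmooth h.minkowski)).congr fun _ hu _ hv =>
    h.distortion_eq hu hv

theorem slitSmooth_localS (h : IsMonochromaticOn L f A U) : SlitSmooth U (localS L) :=
  h.slitSmooth.localS h.isOpen (fun _ hu _ hv => h.det_gMatrix_pos hu hv) h.slitSmooth_distortion

/-- By the chain rule, all horizontal and vertical derivatives of $\tau(u,v)=\tau_f(A_uv)$ factor
through $d\tau_f$ at $A_uv$, which is zero on `W₁` and `W₂`. The spray coefficients play no role. -/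
theorem localS_eq_zero_of_mem (h : IsMonochromaticOn L f A U) (hb : DependsOnLengths f b W₁ W₂)
    (hu : u ∈ U) (hv : v ≠ 0) (hw : A u v ∈ W₁ ∨ A u v ∈ W₂) : localS L u v = 0 := by
  have h0 := hb.fderiv_distortion_eq_zero (p := 0) h.minkowski (h.apply_ne_zero hu hv) hw
  have h1 := hasFDerivAt_of_contDiffOn_compl_zero (distortion_slitSmooth (p := 0) h.minkowski)
    (h.apply_ne_zero hu hv)
  rw [h0] at h1
  have hA : DifferentiableAt ℝ A u :=
    (h.smooth.contDiffAt (h.isOpen.mem_nhds hu)).differentiableAt (by simp)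
  have hx : ∀ i, dx i (distortion L) u v = 0 := by
    intro i
    rw [dx_congr (f := fun u v => distortion (fun _ => f) 0 (A u v)) h.isOpen
      (fun u hu v hv => h.distortion_eq hu hv) hu hv]
    have h2 := h1.comp u (hA.clm_apply (differentiableAt_const v)).hasFDerivAt
    rw [ContinuousLinearMap.zero_comp] at h2
    exact (h2.hasLineDerivAt _).lineDeriv
  have hy : ∀ i, dy i (distortion L) u v = 0 := by
    intro i
    rw [dy_congr (f := fun u v => distortion (fun _ => f) 0 (A u v))
      (fun v hv => h.distortion_eq hu hv) hv]
    have h2 := h1.comp v (A u).hasFDerivAt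
    rw [ContinuousLinearMap.zero_comp] at h2
    exact (h2.hasLineDerivAt _).lineDeriv
  simp [localS, hx, hy]

theorem exists_add_eq (h : IsMonochromaticOn L f A U) (hW : IsCompl W₁ W₂) (hu : u ∈ U)
    (v : EuclideanSpace ℝ (Fin n)) : ∃ v₁ v₂, v₁ + v₂ = v ∧ A u v₁ ∈ W₁ ∧ A u v₂ ∈ W₂ := by
  obtain ⟨w₁, hw₁, w₂, hw₂, hw⟩ := exists_add_eq_of_isCompl hW (A u v)
  have hs : Function.Surjective (A u) :=
    (LinearMap.injective_iff_surjective (f := (A u).toLinearMap)).1 (h.injective u hu)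
  obtain ⟨v₁, rfl⟩ := hs w₁
  obtain ⟨v₂, rfl⟩ := hs w₂
  exact ⟨v₁, v₂, h.injective u hu (by rw [map_add, hw]), hw₁, hw₂⟩

theorem localE_eq (h : IsMonochromaticOn L f A U) (hu : u ∈ U) (hv : v ≠ 0) (i j : Fin n) :
    localE L i j u v = 1 / 2 * dy i (dy j (localS L)) u v :=
  Finsler.localE_eq h.isOpen h.slitSmooth (fun _ hu _ hv => h.det_gMatrix_pos hu hv)
    (fun _ hu => h.bhDensity_pos hu) (fun _ hu => h.differentiableAt_bhDensity hu) hu hv i j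

theorem localE_eq_zero (h : IsMonochromaticOn L f A U) (hu : u ∈ U)
    (hS : ∀ v ≠ 0, localS L u v = 0) (hv : v ≠ 0) (i j : Fin n) : localE L i j u v = 0 := by
  have h0 : ∀ (k : Fin n) (v : EuclideanSpace ℝ (Fin n)),
      dy k (fun _ _ => (0 : ℝ)) u v = 0 := fun k v => by
    simp [dy, lineDeriv]
  have h1 : ∀ v ≠ 0, dy j (localS L) u v = 0 := fun v hv => by
    rw [dy_congr (f := fun _ _ => 0) hS hv, h0]
  rw [h.localE_eq hu hv, dy_congr (f := fun _ _ => 0) h1 hv, h0, mul_zero]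

/-- Restricted to a line missing the origin, `S` has zero second derivative, so it is affine, and
two zeros make it vanish identically on that line. -/
theorem eq_zero_of_fderiv_fderiv_eq_zero {S : EuclideanSpace ℝ (Fin n) → ℝ}
    (hS : ContDiffOn ℝ ∞ S {0}ᶜ) (h2 : ∀ v ≠ 0, fderiv ℝ (fderiv ℝ S) v = 0)
    {v₁ v₂ : EuclideanSpace ℝ (Fin n)} (hne : ∀ t : ℝ, v₁ + t • (v₂ - v₁) ≠ 0)
    (h₁ : S v₁ = 0) (h₂ : S v₂ = 0) (t : ℝ) : S (v₁ + t • (v₂ - v₁)) = 0 := by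
  set d := v₂ - v₁ with hd
  have hc : ∀ t : ℝ, HasDerivAt (fun t : ℝ => v₁ + t • d) d t := fun t => by
    simpa using ((hasDerivAt_id t).smul_const d).const_add v₁
  have hφ : ∀ t : ℝ, HasDerivAt (fun t : ℝ => S (v₁ + t • d)) (fderiv ℝ S (v₁ + t • d) d) t :=
    fun t => (hasFDerivAt_of_contDiffOn_compl_zero hS (hne t)).comp_hasDerivAt t (hc t)
  have hφ' : ∀ t : ℝ, HasDerivAt (fun t : ℝ => fderiv ℝ S (v₁ + t • d) d) 0 t := by
    intro t
    have h3 := hasFDerivAt_fderiv_of_contDiffOn_compl_zero hS (hne t)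
    rw [h2 _ (hne t)] at h3
    have h4 := h3.comp_hasDerivAt t (hc t)
    simpa using h4.clm_apply (hasDerivAt_const t d)
  have hconst : ∀ t : ℝ, fderiv ℝ S (v₁ + t • d) d = fderiv ℝ S (v₁ + (0 : ℝ) • d) d :=
    fun t => is_const_of_deriv_eq_zero (f := fun t : ℝ => fderiv ℝ S (v₁ + t • d) d)
      (fun t => (hφ' t).differentiableAt) (fun t => (hφ' t).deriv) t 0
  set k := fderiv ℝ S (v₁ + (0 : ℝ) • d) d
  have hψ : ∀ t : ℝ, HasDerivAt (fun t : ℝ => S (v₁ + t • d) - t * k) 0 t := by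
    intro t
    have := (hφ t).fun_sub ((hasDerivAt_id t).mul_const k)
    rw [hconst t] at this
    simpa using this
  have hψc : ∀ t : ℝ, S (v₁ + t • d) - t * k = S (v₁ + (0 : ℝ) • d) - 0 * k :=
    fun t => is_const_of_deriv_eq_zero (f := fun t : ℝ => S (v₁ + t • d) - t * k)
      (fun t => (hψ t).differentiableAt) (fun t => (hψ t).deriv) t 0
  have e1 := hψc 1
  have e2 := hψc t
  simp only [hd, one_smul, zero_smul, add_zero, add_sub_cancel, h₁, h₂] at e1 e2
  have hk : k = 0 := by linarith
  rw [hk] at e2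
  linarith

/-- Zero E-curvature makes $S$ affine along the line joining the doubled components of the vector,
at which it vanishes. -/
theorem localS_eq_zero (h : IsMonochromaticOn L f A U) (hb : DependsOnLengths f b W₁ W₂)
    (hu : u ∈ U) (hE : ∀ v ≠ 0, ∀ i j, localE L i j u v = 0) (hv : v ≠ 0) :
    localS L u v = 0 := by
  obtain ⟨v₁, v₂, rfl, h₁, h₂⟩ := h.exists_add_eq hb.isCompl hu v
  -- If one component is zero, the vector already lies in a summand; the line argument needs both
  -- endpoints nonzero.
  rcases eq_or_ne v₁ 0 with h10 | h10
  · exact h.localS_eq_zero_of_mem hb hu hv (.inr (by simpa [h10] using h₂))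
  rcases eq_or_ne v₂ 0 with h20 | h20
  · exact h.localS_eq_zero_of_mem hb hu hv (.inl (by simpa [h20] using h₁))
  have hS : ContDiffOn ℝ ∞ (localS L u) {0}ᶜ :=
    ContDiffOn.comp (g := Function.uncurry (localS L)) (f := fun v => (u, v)) h.slitSmooth_localS
      (contDiff_const.prodMk contDiff_id).contDiffOn fun v hv => ⟨hu, hv⟩
  have hS2 : ∀ v ≠ 0, fderiv ℝ (fderiv ℝ (localS L u)) v = 0 := by
    intro v hv
    refine ContinuousLinearMap.coe_injective
      ((EuclideanSpace.basisFun (Fin n) ℝ).toBasis.ext fun i => ?_)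
    refine ContinuousLinearMap.coe_injective
      ((EuclideanSpace.basisFun (Fin n) ℝ).toBasis.ext fun j => ?_)
    have e1 := lineDeriv_lineDeriv_comp (A := .id ℝ _) hS Function.injective_id hv
      (EuclideanSpace.single j 1) (EuclideanSpace.single i 1)
    have e2 : dy i (dy j (localS L)) u v = 0 := by
      have := h.localE_eq hu hv i j
      rw [hE v hv] at this
      linarith
    simpa using e1.symm.trans e2
  -- The factor 2 places `v₁ + v₂` at the parameter `1 / 2`. The line misses the origin because
  -- nonzero vectors from complementary subspaces are independent.
  have hne : ∀ t : ℝ, (2 : ℝ) • v₁ + t • ((2 : ℝ) • v₂ - (2 : ℝ) • v₁) ≠ 0 := by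
    intro t ht
    have e1 : A u ((2 * (1 - t)) • v₁) = A u (-((2 * t) • v₂)) := by
      congr 1
      rw [← sub_eq_zero, ← ht]
      module
    have e2 : A u ((2 * (1 - t)) • v₁) ∈ W₁ ⊓ W₂ := by
      refine ⟨by rw [map_smul]; exact W₁.smul_mem _ h₁, ?_⟩
      rw [SetLike.mem_coe, e1, map_neg, map_smul]
      exact W₂.neg_mem (W₂.smul_mem _ h₂)
    rw [hb.isCompl.inf_eq_bot, Submodule.mem_bot] at e2
    have e3 := e1
    rw [e2] at e3
    have e4 : (2 * (1 - t)) • v₁ = 0 := h.injective u hu (by simpa using e2)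
    have e5 : -((2 * t) • v₂) = 0 := h.injective u hu (by simpa using e3.symm)
    simp only [neg_eq_zero, smul_eq_zero, h10, h20, or_false] at e4 e5
    linarith
  have hmem : ∀ {v : EuclideanSpace ℝ (Fin n)}, v ≠ 0 → (A u v ∈ W₁ ∨ A u v ∈ W₂) →
      localS L u ((2 : ℝ) • v) = 0 := by
    intro v hv hw
    refine h.localS_eq_zero_of_mem hb hu (smul_ne_zero two_ne_zero hv) ?_
    rw [map_smul]
    exact hw.imp (W₁.smul_mem _) (W₂.smul_mem _)
  have := eq_zero_of_fderiv_fderiv_eq_zero hS hS2 hne (hmem h10 (.inl h₁)) (hmem h20 (.inr h₂))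
    (1 / 2)
  convert this using 2
  module

end IsMonochromaticOn

end LocalForm

/-! ### Expansion in orthonormal families. -/

section Orthonormal

variable {V : Type*} [AddCommGroup V] [Module ℝ V] [TopologicalSpace V]
  {b : V →L[ℝ] V →L[ℝ] ℝ} {k : ℕ} {e : Fin k → V}

theorem sum_smul_eq_of_mem_span (he : ∀ i j, b (e i) (e j) = if i = j then 1 else 0) {y : V}
    (hy : y ∈ Submodule.span ℝ (Set.range e)) : ∑ i, b (e i) y • e i = y := by
  obtain ⟨c, rfl⟩ := (Submodule.mem_span_range_iff_exists_fun ℝ).1 hy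
  simp [he]

theorem inner_sum_smul_self (he : ∀ i j, b (e i) (e j) = if i = j then 1 else 0)
    (c : Fin k → ℝ) : b (∑ i, c i • e i) (∑ i, c i • e i) = ∑ i, c i ^ 2 := by
  simp [he, sq]

end Orthonormal

/-! ### Smooth orthonormal frames of sub-bundles. -/

section Frames

variable {n : ℕ} {M : Type*} [TopologicalSpace M] [ChartedSpace (EuclideanSpace ℝ (Fin n)) M]
  [IsManifold (𝓡 n) ∞ M]

/-- Smoothness on a set of the scalar product of two vector fields along a smooth map. -/
theorem contMDiffOn_inner
    {H' E' N : Type*} [NormedAddCommGroup E'] [NormedSpace ℝ E'] [TopologicalSpace H']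
    {I' : ModelWithCorners ℝ E' H'} [TopologicalSpace N] [ChartedSpace H' N]
    (α : Bundle.ContMDiffRiemannianMetric (𝓡 n) ∞ (EuclideanSpace ℝ (Fin n))
      (fun x : M => TangentSpace (𝓡 n) x)) {U : Set N} {g : N → M}
    {X Y : ∀ p : N, TangentSpace (𝓡 n) (g p)}
    (hX : ContMDiffOn I' (𝓡 n).tangent ∞
      (fun p => (⟨g p, X p⟩ : TangentBundle (𝓡 n) M)) U)
    (hY : ContMDiffOn I' (𝓡 n).tangent ∞
      (fun p => (⟨g p, Y p⟩ : TangentBundle (𝓡 n) M)) U) :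
    ContMDiffOn I' 𝓘(ℝ, ℝ) ∞ (fun p => α.inner (g p) (X p) (Y p)) U := by
  have hg : ContMDiffOn I' (𝓡 n) ∞ g U := fun p hp =>
    (Bundle.contMDiffWithinAt_totalSpace.1 (hX p hp)).1
  -- The scalar product is viewed as a section of the trivial line bundle, so that smoothness of
  -- evaluating a bilinear bundle map applies.
  have h : ContMDiffOn I' ((𝓡 n).prod 𝓘(ℝ)) ∞
      (fun p => Bundle.TotalSpace.mk' ℝ (E := Bundle.Trivial M ℝ) (g p)
        (α.inner (g p) (X p) (Y p))) U :=
    ContMDiffOn.clm_bundle_apply₂ (F₁ := EuclideanSpace ℝ (Fin n)) (F₂ := EuclideanSpace ℝ (Fin n))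
      (α.contMDiff.comp_contMDiffOn hg) hX hY
  exact fun p hp => (Bundle.contMDiffWithinAt_totalSpace.1 (h p hp)).2

/-- Gram–Schmidt orthonormalization of smooth frames of a sub-bundle of the tangent bundle. -/
theorem exists_orthonormal_frame
    (α : Bundle.ContMDiffRiemannianMetric (𝓡 n) ∞ (EuclideanSpace ℝ (Fin n))
      (fun x : M => TangentSpace (𝓡 n) x)) {U : Set M} (k : ℕ)
    (X : Fin k → ∀ p : M, TangentSpace (𝓡 n) p)
    (hX : ∀ a, ContMDiffOn (𝓡 n) (𝓡 n).tangent ∞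
      (fun p => (⟨p, X a p⟩ : TangentBundle (𝓡 n) M)) U)
    (hli : ∀ p ∈ U, LinearIndependent ℝ (fun a => X a p)) :
    ∃ e : Fin k → ∀ p : M, TangentSpace (𝓡 n) p,
      (∀ a, ContMDiffOn (𝓡 n) (𝓡 n).tangent ∞
        (fun p => (⟨p, e a p⟩ : TangentBundle (𝓡 n) M)) U) ∧
      ∀ p ∈ U, (∀ i j, α.inner p (e i p) (e j p) = if i = j then 1 else 0) ∧
        Submodule.span ℝ (Set.range fun a => e a p) =
          Submodule.span ℝ (Set.range fun a => X a p) := by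
  induction k with
  | zero => exact ⟨X, hX, fun p _ => ⟨fun i => i.elim0, rfl⟩⟩
  | succ k ih =>
    have hsnoc : ∀ p, (fun a => X a p) =
        Fin.snoc (α := fun _ => TangentSpace (𝓡 n) p)
          (fun a : Fin k => X a.castSucc p) (X (Fin.last k) p) := fun p =>
      (Fin.snoc_init_self (fun a => X a p)).symm
    have hli' : ∀ p ∈ U, LinearIndependent ℝ (fun a : Fin k => X a.castSucc p) ∧
        X (Fin.last k) p ∉ Submodule.span ℝ (Set.range fun a : Fin k => X a.castSucc p) := by
      intro p hp
      have := hli p hp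
      rw [hsnoc] at this
      exact linearIndependent_finSnoc.1 this
    obtain ⟨e, he, hes⟩ := ih (fun a => X a.castSucc) (fun a => hX _) fun p hp => (hli' p hp).1
    set Y : ∀ p : M, TangentSpace (𝓡 n) p := X (Fin.last k) with hY
    -- The last field minus its projection on the span of the earlier ones; linear independence
    -- keeps it nonzero on `U`.
    set Z : ∀ p : M, TangentSpace (𝓡 n) p :=
      fun p => Y p - ∑ a, α.inner p (e a p) (Y p) • e a p with hZ
    have hsum : ∀ p ∈ U, ∑ a, α.inner p (e a p) (Y p) • e a p ∈
        Submodule.span ℝ (Set.range fun a : Fin k => X a.castSucc p) := by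
      intro p hp
      rw [← (hes p hp).2]
      exact Submodule.sum_mem _ fun a _ =>
        Submodule.smul_mem _ _ (Submodule.subset_span ⟨a, rfl⟩)
    have hZ0 : ∀ p ∈ U, Z p ≠ 0 := by
      intro p hp h0
      apply (hli' p hp).2
      rw [sub_eq_zero.1 h0]
      exact hsum p hp
    have hZs : ContMDiffOn (𝓡 n) (𝓡 n).tangent ∞
        (fun p => (⟨p, Z p⟩ : TangentBundle (𝓡 n) M)) U :=
      (hX (Fin.last k)).sub_section (ContMDiffOn.sum_section fun a _ =>
        (contMDiffOn_inner (g := fun p => p) α (he a) (hX (Fin.last k))).smul_section (he a))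
    have hpos : ∀ p ∈ U, 0 < α.inner p (Z p) (Z p) := fun p hp => α.pos p _ (hZ0 p hp)
    set c : M → ℝ := fun p => (Real.sqrt (α.inner p (Z p) (Z p)))⁻¹ with hc
    have hc0 : ∀ p ∈ U, c p ≠ 0 := fun p hp => inv_ne_zero (Real.sqrt_pos.2 (hpos p hp)).ne'
    have hcs : ContMDiffOn (𝓡 n) 𝓘(ℝ, ℝ) ∞ c U := by
      have h1 := contMDiffOn_inner (g := fun p => p) α hZs hZs
      -- On the negative axis `Real.sqrt` is 0, so this function is locally constant there and
      -- smooth on all of `{0}ᶜ`.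
      have h2 : ContDiffOn ℝ ∞ (fun r : ℝ => (Real.sqrt r)⁻¹) {0}ᶜ := by
        intro r hr
        by_cases hr' : 0 < r
        · exact ((Real.contDiffAt_sqrt hr).inv (Real.sqrt_pos.2 hr').ne').contDiffWithinAt
        · have hr'' : r < 0 := lt_of_le_of_ne (not_lt.1 hr') hr
          refine (contDiffAt_const (c := (0 : ℝ))).congr_of_eventuallyEq ?_ |>.contDiffWithinAt
          filter_upwards [gt_mem_nhds hr''] with s hs
          simp [Real.sqrt_eq_zero_of_nonpos hs.le]
      exact h2.contMDiffOn.comp h1 fun p hp => (hpos p hp).ne'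
    have hortho : ∀ p ∈ U, ∀ a, α.inner p (e a p) (Z p) = 0 := by
      intro p hp a
      simp [hZ, (hes p hp).1]
    have hnorm : ∀ p ∈ U, α.inner p (c p • Z p) (c p • Z p) = 1 := by
      intro p hp
      have h1 := Real.mul_self_sqrt (hpos p hp).le
      have h2 := (Real.sqrt_pos.2 (hpos p hp)).ne'
      simp only [map_smul, _root_.smul_apply, smul_eq_mul, hc]
      field_simp
      rw [sq, h1]
    refine ⟨Fin.snoc (α := fun _ => ∀ p : M, TangentSpace (𝓡 n) p) e fun p => c p • Z p, ?_, ?_⟩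
    · intro a
      induction a using Fin.lastCases with
      | last =>
        simp only [Fin.snoc_last]
        exact hcs.smul_section hZs
      | cast a =>
        simp only [Fin.snoc_castSucc]
        exact he a
    · intro p hp
      constructor
      · intro i j
        induction i using Fin.lastCases with
        | last =>
          induction j using Fin.lastCases with
          | last => simpa using hnorm p hp
          | cast j =>
            simp only [Fin.snoc_last, Fin.snoc_castSucc]
            rw [if_neg (Fin.castSucc_lt_last j).ne', α.symm, map_smul, hortho p hp, smul_zero]
        | cast i =>
          induction j using Fin.lastCases with
          | last =>
            simp only [Fin.snoc_last, Fin.snoc_castSucc]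
            rw [if_neg (Fin.castSucc_lt_last i).ne, map_smul, hortho p hp, smul_zero]
          | cast j => simpa using (hes p hp).1 i j
      · have h1 : (fun a => (Fin.snoc (α := fun _ => ∀ p : M, TangentSpace (𝓡 n) p) e
            (fun p => c p • Z p) : Fin (k + 1) → ∀ p : M, TangentSpace (𝓡 n) p) a p) =
            Fin.snoc (α := fun _ => TangentSpace (𝓡 n) p) (fun a => e a p) (c p • Z p) := by
          ext1 a
          induction a using Fin.lastCases with
          | last => simp
          | cast a => simp
        rw [h1, hsnoc p, Fin.range_snoc, Fin.range_snoc, Submodule.span_insert,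
          Submodule.span_insert, (hes p hp).2]
        set S := Submodule.span ℝ (Set.range fun a : Fin k => X a.castSucc p)
        have hYZ : Y p = (c p)⁻¹ • c p • Z p + ∑ a, α.inner p (e a p) (Y p) • e a p := by
          rw [inv_smul_smul₀ (hc0 p hp), sub_add_cancel]
        apply le_antisymm <;> refine sup_le ?_ le_sup_right <;>
          rw [Submodule.span_singleton_le_iff_mem]
        · exact Submodule.smul_mem _ _ (Submodule.sub_mem _
            (le_sup_left (a := Submodule.span ℝ {Y p}) (Submodule.mem_span_singleton_self _))
            (le_sup_right (b := S) (hsum p hp)))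
        · rw [hYZ]
          exact Submodule.add_mem _ (Submodule.smul_mem _ _
            (le_sup_left (a := Submodule.span ℝ {c p • Z p})
              (Submodule.mem_span_singleton_self _)))
            (le_sup_right (b := S) (hsum p hp))

end Frames

/-! ### Passage from charts to the manifold, and the four implications. -/

section Charts

variable {n : ℕ} {M : Type*} [TopologicalSpace M] [ChartedSpace (EuclideanSpace ℝ (Fin n)) M]
  {F : TangentBundle (𝓡 n) M → ℝ}
  {φ : OpenPartialHomeomorph M (EuclideanSpace ℝ (Fin n))}

theorem mdifferentiable_of_mem_maximalAtlas (hφ : φ ∈ IsManifold.maximalAtlas (𝓡 n) ∞ M) :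
    φ.MDifferentiable (𝓡 n) (𝓡 n) :=
  ⟨(contMDiffOn_of_mem_maximalAtlas hφ).mdifferentiableOn (by simp),
    (contMDiffOn_symm_of_mem_maximalAtlas hφ).mdifferentiableOn (by simp)⟩

theorem coordVec_bijective (hφ : φ ∈ IsManifold.maximalAtlas (𝓡 n) ∞ M) {x : M}
    (hx : x ∈ φ.source) : Function.Bijective (coordVec φ x) :=
  (mdifferentiable_of_mem_maximalAtlas hφ).mfderiv_bijective hx

theorem coordVec_zero (x : M) : coordVec φ x 0 = 0 :=
  map_zero (mfderiv (𝓡 n) (𝓡 n) φ x)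

theorem coordVec_neg (x : M) (y : TangentSpace (𝓡 n) x) :
    coordVec φ x (-y) = -coordVec φ x y :=
  map_neg (mfderiv (𝓡 n) (𝓡 n) φ x) y

theorem coordVec_add (x : M) (y z : TangentSpace (𝓡 n) x) :
    coordVec φ x (y + z) = coordVec φ x y + coordVec φ x z :=
  map_add (mfderiv (𝓡 n) (𝓡 n) φ x) y z

theorem coordVec_ne_zero (hφ : φ ∈ IsManifold.maximalAtlas (𝓡 n) ∞ M) {x : M}
    (hx : x ∈ φ.source) {y : TangentSpace (𝓡 n) x} (hy : y ≠ 0) : coordVec φ x y ≠ 0 :=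
  fun h => hy ((coordVec_bijective hφ hx).1 (h.trans (coordVec_zero x).symm))

variable [IsManifold (𝓡 n) ∞ M]

/-- The coordinate vector fields of a chart are smooth. -/
theorem contMDiffOn_mfderiv_symm (hφ : φ ∈ IsManifold.maximalAtlas (𝓡 n) ∞ M)
    (v : EuclideanSpace ℝ (Fin n)) :
    ContMDiffOn (𝓡 n) (𝓡 n).tangent ∞
      (fun u => (⟨φ.symm u, mfderiv (𝓡 n) (𝓡 n) φ.symm u v⟩ : TangentBundle (𝓡 n) M))
      φ.target := by
  have h1 := (contMDiffOn_symm_of_mem_maximalAtlas hφ).contMDiffOn_tangentMapWithin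
    (m := ∞) (by simp) φ.open_target.uniqueMDiffOn
  have h2 : ContMDiffOn (𝓡 n) (𝓡 n).tangent ∞
      (fun u => (⟨u, v⟩ : TangentBundle (𝓡 n) (EuclideanSpace ℝ (Fin n)))) φ.target :=
    contMDiffOn_vectorSpace_iff_contDiffOn.2 contDiffOn_const
  refine (h1.comp h2 fun u hu => hu).congr fun u hu => ?_
  simp only [Function.comp, tangentMapWithin, mfderivWithin_of_isOpen φ.open_target hu]

theorem IsAlphaOneAlphaTwo.map_neg (hF : IsAlphaOneAlphaTwo F) (x : M)
    (y : TangentSpace (𝓡 n) x) : F ⟨x, -y⟩ = F ⟨x, y⟩ := by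
  obtain ⟨-, α, n₁, n₂, V₁, V₂, -, -, hc, -, h⟩ := hF
  obtain ⟨y₁, hy₁, y₂, hy₂, rfl⟩ := Submodule.mem_sup.1
    (show y ∈ V₁ x ⊔ V₂ x by simp [(hc x).sup_eq_top])
  rw [neg_add]
  exact h x _ ((V₁ x).neg_mem hy₁) _ ((V₂ x).neg_mem hy₂) x _ hy₁ _ hy₂ (by simp) (by simp)

theorem IsAlphaOneAlphaTwo.hasParity_coordExpr (hF : IsAlphaOneAlphaTwo F)
    (φ : OpenPartialHomeomorph M (EuclideanSpace ℝ (Fin n))) : HasParity 1 (coordExpr F φ) := by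
  intro u v
  have h : mfderiv (𝓡 n) (𝓡 n) φ.symm u (-v) = -mfderiv (𝓡 n) (𝓡 n) φ.symm u v :=
    _root_.map_neg (mfderiv (𝓡 n) (𝓡 n) φ.symm u) v
  rw [coordExpr, h, hF.map_neg, one_mul]
  rfl

/-- In every chart, an `(α₁, α₂)` metric is locally a fixed Minkowski norm up to a smooth family of
linear isomorphisms. -/
theorem IsAlphaOneAlphaTwo.exists_isMonochromaticOn (hF : IsAlphaOneAlphaTwo F)
    (hφ : φ ∈ IsManifold.maximalAtlas (𝓡 n) ∞ M) {x₀ : M} (hx₀ : x₀ ∈ φ.source) :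
    ∃ f A U b W₁ W₂, φ x₀ ∈ U ∧ IsMonochromaticOn (coordExpr F φ) f A U ∧
      DependsOnLengths f b W₁ W₂ := by
  obtain ⟨hFin, α, n₁, n₂, V₁, V₂, hV₁, hV₂, hc, ho, h⟩ := hF
  obtain ⟨U₁, hU₁, hxU₁, X₁, hX₁, hXV₁⟩ := hV₁ x₀
  obtain ⟨U₂, hU₂, hxU₂, X₂, hX₂, hXV₂⟩ := hV₂ x₀
  obtain ⟨e₁, he₁, hes₁⟩ := exists_orthonormal_frame α n₁ X₁ hX₁ fun p hp => (hXV₁ p hp).1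
  obtain ⟨e₂, he₂, hes₂⟩ := exists_orthonormal_frame α n₂ X₂ hX₂ fun p hp => (hXV₂ p hp).1
  have hspan₁ : ∀ p ∈ U₁, Submodule.span ℝ (Set.range fun a => e₁ a p) = V₁ p :=
    fun p hp => (hes₁ p hp).2.trans (hXV₁ p hp).2
  have hspan₂ : ∀ p ∈ U₂, Submodule.span ℝ (Set.range fun a => e₂ a p) = V₂ p :=
    fun p hp => (hes₂ p hp).2.trans (hXV₂ p hp).2
  have hmem₁ : ∀ p ∈ U₁, ∀ a, e₁ a p ∈ V₁ p := fun p hp a => by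
    rw [← hspan₁ p hp]
    exact Submodule.subset_span ⟨a, rfl⟩
  have hmem₂ : ∀ p ∈ U₂, ∀ a, e₂ a p ∈ V₂ p := fun p hp a => by
    rw [← hspan₂ p hp]
    exact Submodule.subset_span ⟨a, rfl⟩
  -- The model norm is $F$ on the tangent space at the base point `x₀`.
  set f : EuclideanSpace ℝ (Fin n) → ℝ := fun y => F ⟨x₀, y⟩ with hf
  have hmink : IsMinkowskiNorm f := hFin.minkowski x₀
  set ψ : ∀ u : EuclideanSpace ℝ (Fin n),
    EuclideanSpace ℝ (Fin n) →L[ℝ] TangentSpace (𝓡 n) (φ.symm u) :=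
      fun u => mfderiv (𝓡 n) (𝓡 n) φ.symm u with hψ
  set U := φ.target ∩ φ.symm ⁻¹' (U₁ ∩ U₂) with hU
  have hUo : IsOpen U := φ.symm.isOpen_inter_preimage (hU₁.inter hU₂)
  -- `A u` transports the tangent space at `φ.symm u` to the one at `x₀` by matching the orthonormal
  -- frames of each sub-bundle. This preserves both component lengths, hence $F$.
  set A : EuclideanSpace ℝ (Fin n) → EuclideanSpace ℝ (Fin n) →L[ℝ] EuclideanSpace ℝ (Fin n) :=
    fun u => ∑ a, ((α.inner (φ.symm u) (e₁ a (φ.symm u))).comp (ψ u)).smulRight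
        (show EuclideanSpace ℝ (Fin n) from e₁ a x₀) +
      ∑ a, ((α.inner (φ.symm u) (e₂ a (φ.symm u))).comp (ψ u)).smulRight
        (show EuclideanSpace ℝ (Fin n) from e₂ a x₀) with hA
  have hAapply : ∀ u v, A u v =
      ∑ a, α.inner (φ.symm u) (e₁ a (φ.symm u)) (ψ u v) •
        (show EuclideanSpace ℝ (Fin n) from e₁ a x₀) +
      ∑ a, α.inner (φ.symm u) (e₂ a (φ.symm u)) (ψ u v) •
        (show EuclideanSpace ℝ (Fin n) from e₂ a x₀) := by
    intro u v
    simp only [hA, _root_.add_apply, _root_.sum_apply]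
    rfl
  have hcoef : ∀ (e : ∀ p : M, TangentSpace (𝓡 n) p) (U' : Set M), U₁ ∩ U₂ ⊆ U' →
      ContMDiffOn (𝓡 n) (𝓡 n).tangent ∞ (fun p => (⟨p, e p⟩ : TangentBundle (𝓡 n) M)) U' →
      ∀ v, ContDiffOn ℝ ∞ (fun u => α.inner (φ.symm u) (e (φ.symm u)) (ψ u v)) U := by
    intro e U' hU' he v
    have h1 : ContMDiffOn (𝓡 n) (𝓡 n).tangent ∞
        (fun u => (⟨φ.symm u, e (φ.symm u)⟩ : TangentBundle (𝓡 n) M)) U :=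
      he.comp ((contMDiffOn_symm_of_mem_maximalAtlas hφ).mono Set.inter_subset_left)
        fun u hu => hU' hu.2
    exact contMDiffOn_iff_contDiffOn.1 (contMDiffOn_inner α h1
      ((contMDiffOn_mfderiv_symm hφ v).mono Set.inter_subset_left))
  have hAs : ContDiffOn ℝ ∞ A U := by
    rw [contDiffOn_clm_apply]
    intro v
    simp only [hAapply]
    exact (ContDiffOn.sum fun a _ => (hcoef _ _ Set.inter_subset_left (he₁ a) v).smul
      contDiffOn_const).add (ContDiffOn.sum fun a _ =>
        (hcoef _ _ Set.inter_subset_right (he₂ a) v).smul contDiffOn_const)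
  have heq : ∀ u ∈ U, ∀ v, coordExpr F φ u v = f (A u v) := by
    intro u hu v
    obtain ⟨hu₁, hu₂⟩ := hu.2
    obtain ⟨y₁, hy₁, y₂, hy₂, hy⟩ := Submodule.mem_sup.1
      (show ψ u v ∈ V₁ (φ.symm u) ⊔ V₂ (φ.symm u) by simp [(hc _).sup_eq_top])
    have hc₁ : ∀ a, α.inner (φ.symm u) (e₁ a (φ.symm u)) (ψ u v) =
        α.inner (φ.symm u) (e₁ a (φ.symm u)) y₁ := by
      intro a
      rw [← hy, map_add, ho _ _ (hmem₁ _ hu₁ a) _ hy₂, add_zero]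
    have hc₂ : ∀ a, α.inner (φ.symm u) (e₂ a (φ.symm u)) (ψ u v) =
        α.inner (φ.symm u) (e₂ a (φ.symm u)) y₂ := by
      intro a
      rw [← hy, map_add, α.symm _ _ y₁, ho _ _ hy₁ _ (hmem₂ _ hu₂ a), zero_add]
    have hlen₁ : α.inner (φ.symm u) y₁ y₁ =
        ∑ a, (α.inner (φ.symm u) (e₁ a (φ.symm u)) y₁) ^ 2 := by
      have h1 := inner_sum_smul_self (hes₁ _ hu₁).1
        (fun a => α.inner (φ.symm u) (e₁ a (φ.symm u)) y₁)
      rwa [sum_smul_eq_of_mem_span (hes₁ _ hu₁).1 (by rwa [hspan₁ _ hu₁])] at h1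
    have hlen₂ : α.inner (φ.symm u) y₂ y₂ =
        ∑ a, (α.inner (φ.symm u) (e₂ a (φ.symm u)) y₂) ^ 2 := by
      have h1 := inner_sum_smul_self (hes₂ _ hu₂).1
        (fun a => α.inner (φ.symm u) (e₂ a (φ.symm u)) y₂)
      rwa [sum_smul_eq_of_mem_span (hes₂ _ hu₂).1 (by rwa [hspan₂ _ hu₂])] at h1
    have h1 := h (φ.symm u) y₁ hy₁ y₂ hy₂ x₀
      (∑ a, α.inner (φ.symm u) (e₁ a (φ.symm u)) y₁ • e₁ a x₀)
      (Submodule.sum_mem _ fun a _ => Submodule.smul_mem _ _ (hmem₁ _ hxU₁ a))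
      (∑ a, α.inner (φ.symm u) (e₂ a (φ.symm u)) y₂ • e₂ a x₀)
      (Submodule.sum_mem _ fun a _ => Submodule.smul_mem _ _ (hmem₂ _ hxU₂ a))
      (by rw [hlen₁, inner_sum_smul_self (hes₁ _ hxU₁).1])
      (by rw [hlen₂, inner_sum_smul_self (hes₂ _ hxU₂).1])
    rw [hy] at h1
    rw [hAapply]
    simp only [hc₁, hc₂]
    exact h1
  refine ⟨f, A, U, α.inner x₀, V₁ x₀, V₂ x₀, ?_, ⟨hUo, hmink, hAs, ?_, heq⟩,
    ⟨α.symm x₀, α.pos x₀, hc x₀, ho x₀, fun y₁ hy₁ y₂ hy₂ y₁' hy₁' y₂' hy₂' =>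
      h x₀ y₁ hy₁ y₂ hy₂ x₀ y₁' hy₁' y₂' hy₂'⟩⟩
  · exact ⟨φ.map_source hx₀, by simpa [φ.left_inv hx₀] using ⟨hxU₁, hxU₂⟩⟩
  -- Injectivity comes from the norm rather than from counting frame vectors: if `A u v = 0` then
  -- $F$ vanishes on the corresponding tangent vector, which must be zero.
  · intro u hu
    rw [injective_iff_map_eq_zero]
    intro v hv
    have h0 : f 0 = 0 := by simpa using hmink.homogeneous 0 0 le_rfl
    have h1 : F ⟨φ.symm u, ψ u v⟩ = 0 := by
      have := heq u hu v
      rwa [hv, h0] at this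
    have h2 : ψ u v = 0 := by
      by_contra hne
      exact ((hFin.minkowski (φ.symm u)).pos _ hne).ne' h1
    exact (mdifferentiable_of_mem_maximalAtlas hφ).symm.mfderiv_injective hu.1
      (h2.trans (_root_.map_zero (mfderiv (𝓡 n) (𝓡 n) φ.symm u)).symm)

theorem IsAlphaOneAlphaTwo.sCurvature_neg (hF : IsAlphaOneAlphaTwo F)
    (φ : OpenPartialHomeomorph M (EuclideanSpace ℝ (Fin n))) (x : M) (y : TangentSpace (𝓡 n) x) :
    sCurvature F φ x (-y) = -sCurvature F φ x y := by
  rw [sCurvature, coordVec_neg, (hF.hasParity_coordExpr φ).localS, neg_one_mul]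
  rfl

theorem IsAlphaOneAlphaTwo.eCurvature_neg (hF : IsAlphaOneAlphaTwo F)
    (φ : OpenPartialHomeomorph M (EuclideanSpace ℝ (Fin n))) (i j : Fin n) (x : M)
    (y : TangentSpace (𝓡 n) x) : eCurvature F φ i j x (-y) = -eCurvature F φ i j x y := by
  rw [eCurvature, coordVec_neg, (hF.hasParity_coordExpr φ).localE, neg_one_mul]
  rfl

theorem IsAlphaOneAlphaTwo.hForm_neg (hF : IsAlphaOneAlphaTwo F)
    (φ : OpenPartialHomeomorph M (EuclideanSpace ℝ (Fin n))) (i j : Fin n) (x : M)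
    (y : TangentSpace (𝓡 n) x) : hForm F φ i j x (-y) = hForm F φ i j x y := by
  rw [hForm, coordVec_neg, (hF.hasParity_coordExpr φ).angularForm, one_mul]
  rfl

/-- Oddness of $S$ against evenness of $F$ removes the term in `c`. The remaining one-form vanishes
on both sub-bundles, which span. -/
theorem IsAlphaOneAlphaTwo.vanishingS_of_weaklyIsotropicS (hF : IsAlphaOneAlphaTwo F)
    (hS : WeaklyIsotropicS F) : VanishingS F := by
  obtain ⟨c, ε, hS⟩ := hS
  intro φ hφ x hx y hy
  have hlin : ∀ y : TangentSpace (𝓡 n) x, y ≠ 0 → sCurvature F φ x y = ε x y := by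
    intro y hy
    have h1 := hS φ hφ x hx y hy
    have h2 := hS φ hφ x hx (-y) (neg_ne_zero.2 hy)
    rw [hF.sCurvature_neg, hF.map_neg, _root_.map_neg] at h2
    linarith
  rw [hlin y hy]
  obtain ⟨f, A, U, b, W₁, W₂, hxU, hm, hd⟩ := hF.exists_isMonochromaticOn hφ hx
  obtain ⟨v₁, v₂, hv, h₁, h₂⟩ := hm.exists_add_eq hd.isCompl hxU (coordVec φ x y)
  have key : ∀ y : TangentSpace (𝓡 n) x,
      A (φ x) (coordVec φ x y) ∈ W₁ ∨ A (φ x) (coordVec φ x y) ∈ W₂ → ε x y = 0 := by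
    intro y hy
    by_cases hy0 : y = 0
    · rw [hy0, map_zero]
    · rw [← hlin y hy0]
      exact hm.localS_eq_zero_of_mem hd hxU (coordVec_ne_zero hφ hx hy0) hy
  obtain ⟨y₁, rfl⟩ := (coordVec_bijective hφ hx).2 v₁
  obtain ⟨y₂, rfl⟩ := (coordVec_bijective hφ hx).2 v₂
  rw [← coordVec_add] at hv
  rw [← (coordVec_bijective hφ hx).1 hv, map_add, key y₁ (.inl h₁), key y₂ (.inr h₂), add_zero]

theorem IsAlphaOneAlphaTwo.vanishingE_of_vanishingS (hF : IsAlphaOneAlphaTwo F)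
    (hS : VanishingS F) : VanishingE F := by
  intro φ hφ x hx y hy i j
  obtain ⟨f, A, U, b, W₁, W₂, hxU, hm, hd⟩ := hF.exists_isMonochromaticOn hφ hx
  refine hm.localE_eq_zero hxU (fun v hv => ?_) (coordVec_ne_zero hφ hx hy) i j
  obtain ⟨z, rfl⟩ := (coordVec_bijective hφ hx).2 v
  refine hS φ hφ x hx z ?_
  rintro rfl
  exact hv (coordVec_zero x)

/-- At $y$ and $-y$ the right-hand sides agree, while the left-hand sides are opposite. -/
theorem IsAlphaOneAlphaTwo.vanishingE_of_isotropicE (hF : IsAlphaOneAlphaTwo F)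
    (hE : IsotropicE F) : VanishingE F := by
  obtain ⟨c, hE⟩ := hE
  intro φ hφ x hx y hy i j
  have h1 := hE φ hφ x hx y hy i j
  have h2 := hE φ hφ x hx (-y) (neg_ne_zero.2 hy) i j
  rw [hF.eCurvature_neg, hF.hForm_neg, hF.map_neg] at h2
  linarith

theorem IsAlphaOneAlphaTwo.vanishingS_of_vanishingE (hF : IsAlphaOneAlphaTwo F)
    (hE : VanishingE F) : VanishingS F := by
  intro φ hφ x hx y hy
  obtain ⟨f, A, U, b, W₁, W₂, hxU, hm, hd⟩ := hF.exists_isMonochromaticOn hφ hx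
  refine hm.localS_eq_zero hd hxU (fun v hv i j => ?_) (coordVec_ne_zero hφ hx hy)
  obtain ⟨z, rfl⟩ := (coordVec_bijective hφ hx).2 v
  refine hE φ hφ x hx z ?_ i j
  rintro rfl
  exact hv (coordVec_zero x)

end Charts

end Finsler

theorem theorem1p2 (n : ℕ) (M : Type*) [TopologicalSpace M] [T2Space M]
    [SecondCountableTopology M] [ChartedSpace (EuclideanSpace ℝ (Fin n)) M]
    [IsManifold (𝓡 n) ∞ M]
    (F : TangentBundle (𝓡 n) M → ℝ)
    (hF : Finsler.IsAlphaOneAlphaTwo F) (hhom : Finsler.IsHomogeneous F) :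
    List.TFAE [Finsler.WeaklyIsotropicS F, Finsler.VanishingS F,
      Finsler.IsotropicE F, Finsler.VanishingE F] := by
  tfae_have 1 → 2 := hF.vanishingS_of_weaklyIsotropicS
  tfae_have 2 → 1 := fun h => ⟨0, 0, fun φ hφ x hx y hy => by simp [h φ hφ x hx y hy]⟩
  tfae_have 2 → 4 := hF.vanishingE_of_vanishingS
  tfae_have 4 → 3 := fun h => ⟨0, fun φ hφ x hx y hy i j => by simp [h φ hφ x hx y hy i j]⟩
  tfae_have 3 → 4 := hF.vanishingE_of_isotropicE
  tfae_have 4 → 2 := hF.vanishingS_of_vanishingE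
  tfae_finish
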